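/- Let $d\ge 1$. A point process on $\mathbb{R}^d$ is a random locally finite counting measure, identified with its configuration of points; $|\cdot|$ denotes Lebesgue measure, $B(x,r)$ the closed Euclidean ball and $v_d=|B(0,1)|$. For $r>0$ and a retention rule $p:\mathbb{N}_0\to[0,1]$, the neighbour-count dependent thinning $T_r(X)$ of a point process $X$ is obtained by attaching to the points $x$ of $X$ independent $\mathrm{Uniform}(0,1)$ marks $U_x$, independent of $X$, and retaining $x$ iff $U_x\le p(n_r(x;X))$, where $n_r(x;X)=\#\big((X\cap B(x,r))\setminus\{x\}\big)$. The Laplace functional of a point process $Y$ is $L_Y(g)=\mathbb{E}\big[\exp\big(-\sum_{y\in Y}g(y)\big)\big]$. Theorem (Laplace-functional control). For every $d\ge1$ there exist constants $c_d,C_d\in(0,\infty)$, depending only on $d$, such that the following holds. Let $\lambda>0$, $r>0$ and $p:\mathbb{N}_0\to[0,1]$, let $X$ be a homogeneous Poisson point process on $\mathbb{R}^d$ with intensity $\lambda$, and let $Y=T_r(X)$. Let $W\subset\mathbb{R}^d$ be a bounded Borel set and let $g:\mathbb{R}^d\to[0,\infty)$ be bounded and Borel measurable and vanish outside $W$. Put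 $m_p=\mathbb{E}[p(N)]$ with $N\sim\mathrm{Poisson}(\lambda v_d r^d)$, and let $\Pi$ be a Poisson point process with intensity measure $\lambda m_p\mathbf{1}_W(x)\,dx$. If $\lambda r^d\le c_d$, then $L_\Pi(g)$ and $L_Y(g)$ are positive and $$\big|\log L_\Pi(g)-\log L_Y(g)\big|\ \le\ C_d\,\lambda^2\,\|g\|_\infty\,|W|\,(2r)^d,\qquad \|g\|_\infty=\sup_{x\in\mathbb{R}^d} g(x).$$ -/

import Mathlib

open MeasureTheory ProbabilityTheory
open scoped ENNReal NNReal

noncomputable section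

namespace LocalThinning

/-- `d`-dimensional Euclidean space. -/
abbrev Space (d : ℕ) : Type := EuclideanSpace ℝ (Fin d)

/-- A point process on `ℝ^d`: a measurable map into the space of measures (with the σ-algebra
generated by the evaluations at Borel sets) all of whose values are locally finite counting
measures, i.e. take finite integer values on bounded Borel sets. -/
structure IsPointProcess {d : ℕ} {Ω : Type*} [MeasurableSpace Ω]
    (X : Ω → Measure (Space d)) : Prop where
  measurable : Measurable X
  counting : ∀ ω, ∀ B : Set (Space d), MeasurableSet B → Bornology.IsBounded B →
    ∃ n : ℕ, X ω B = n

/-- `X ∼ PPP(Λ)` under `P`, for an intensity measure `Λ` that is finite on bounded sets: the count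
in a bounded Borel set `B` is `Poisson(Λ(B))`, and the counts in finitely many pairwise disjoint
bounded Borel sets are independent. -/
structure IsPoissonProcess {d : ℕ} {Ω : Type*} [MeasurableSpace Ω] (P : Measure Ω)
    (X : Ω → Measure (Space d)) (Λ : Measure (Space d)) : Prop where
  isPointProcess : IsPointProcess X
  count_law : ∀ B : Set (Space d), MeasurableSet B → Bornology.IsBounded B →
    HasLaw (fun ω => X ω B)
      ((poissonMeasure (Λ B).toNNReal).map (fun n : ℕ => (n : ℝ≥0∞))) P
  count_indep : ∀ (k : ℕ) (A : Fin k → Set (Space d)),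
    (∀ i, MeasurableSet (A i)) → (∀ i, Bornology.IsBounded (A i)) →
    (∀ i j, i ≠ j → Disjoint (A i) (A j)) →
    iIndepFun (fun i ω => X ω (A i)) P

/-- `n_r(x; ν)`, the number of points of the configuration `ν` in the closed ball `B(x, r)` other
than `x`. On locally finite counting measures the floor does nothing but turn the integer
`ν (B(x, r) \ {x})` into a natural number. -/
def neighbourCount {d : ℕ} (r : ℝ) (x : Space d) (ν : Measure (Space d)) : ℕ :=
  ⌊(ν (Metric.closedBall x r \ {x})).toReal⌋₊

/-- `X = ∑_{i < κ} δ_{ξ_i}` is a measurable enumeration of the points of `X`, and the point `ξ_i`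
carries the mark `U_i`; the marks are independent, uniform on `(0, 1)`, and independent of the
enumerated points. -/
structure IsUniformMarking {d : ℕ} {Ω : Type*} [MeasurableSpace Ω] (P : Measure Ω)
    (X : Ω → Measure (Space d)) (κ : Ω → ℕ∞) (ξ : ℕ → Ω → Space d) (U : ℕ → Ω → ℝ) : Prop where
  measurable_card : Measurable κ
  measurable_point : ∀ i, Measurable (ξ i)
  enumerates : ∀ ω,
    X ω = Measure.sum (fun i : ℕ => if (i : ℕ∞) < κ ω then Measure.dirac (ξ i ω) else 0)
  measurable_mark : ∀ i, Measurable (U i)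
  mark_law : ∀ i, HasLaw (U i) (volume.restrict (Set.Ioo (0 : ℝ) 1)) P
  mark_indep : iIndepFun U P
  indep_points : IndepFun (fun ω (i : ℕ) => U i ω) (fun ω => (κ ω, fun i : ℕ => ξ i ω)) P

open Classical in
/-- The neighbour-count dependent thinning `T_r(X)` of `X = ∑_{i < κ} δ_{ξ_i}` with marks `U_i`:
the point `ξ_i` is retained iff `U_i ≤ p(n_r(ξ_i; X))`. -/
def thinning {d : ℕ} {Ω : Type*} (r : ℝ) (p : ℕ → ℝ) (X : Ω → Measure (Space d))
    (κ : Ω → ℕ∞) (ξ : ℕ → Ω → Space d) (U : ℕ → Ω → ℝ) (ω : Ω) : Measure (Space d) :=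
  Measure.sum (fun i : ℕ =>
    if (i : ℕ∞) < κ ω ∧ U i ω ≤ p (neighbourCount r (ξ i ω) (X ω)) then
      Measure.dirac (ξ i ω)
    else 0)

/-- The Laplace functional `L_Y(g) = E[exp(-∑_{y ∈ Y} g(y))]`; the sum over the points of `Y` is
the integral of `g` against the counting measure `Y`. -/
def laplaceFunctional {d : ℕ} {Ω : Type*} [MeasurableSpace Ω] (P : Measure Ω)
    (Y : Ω → Measure (Space d)) (g : Space d → ℝ) : ℝ :=
  ∫ ω, Real.exp (-∫ y, g y ∂(Y ω)) ∂P

/-- `v_d`, the volume of the unit ball. -/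
def unitBallVolume (d : ℕ) : ℝ := (volume (Metric.closedBall (0 : Space d) 1)).toReal

/-- `m_p = E[p(N)]` with `N ∼ Poisson(μ)`, `μ = lam v_d r^d`. -/
def meanRetention (d : ℕ) (lam r : ℝ) (p : ℕ → ℝ) : ℝ :=
  ∫ n, p n ∂(poissonMeasure (lam * unitBallVolume d * r ^ d).toNNReal)

end LocalThinning

end

/-! Given the points of `X`, the marks are independent, so integrating them out turns `L_Y(g)` into
the mean of a product over the points `y` of `X` of the factors `1 - (1 - exp(-g y)) * p(n)`, with
`n` the number of neighbours of `y`; this is `meanWeight` (`laplaceFunctional_thinning`). On the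
Poisson side, `log L_Π(g)` is `-m ∫ (1 - exp(-g)) dΛ` with `m` the mean retention and `Λ` the
intensity measure of `X` (`laplaceFunctional_poisson`). The two logarithms are compared by switching
`g` on cell by cell.

Let `A` be a cell inside a ball of radius `r`, and `B` the concentric ball of radius `2r`. If `B`
contains exactly one point and this point lies in `A`, then it has no neighbours: it is retained
with probability `p 0` and does not influence any other point, so its contribution factorises
exactly. If `B` contains a further point, the contribution is of second order, `Λ A * Λ B`. Hence
the logarithm changes by `-p 0 ∫_A (1 - exp(-g)) dΛ` up to an error of order `(1 - exp(-M)) * Λ A *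
Λ B`, where `M` bounds `g`, and `p 0` differs from `m` by at most `Λ B`. Over disjoint cells the
errors add up to a multiple of `Λ W`, whatever the number of cells (`abs_log_meanWeight_union_le`,
`abs_log_meanWeight_add_le`).

The difficulty is that these errors must be small relative to the mean weight, which may decay
exponentially in the volume of `W`, while `p` is arbitrary, so that extra neighbours can raise or
lower the weight of the other points. The key is `meanWeight_diracSum_le`: at low density an extra
neighbour multiplies the mean weight by at most two. It is proved by exploration: the points near
the extra neighbour are revealed, dropped from the weight and kept only as new extra neighbours, and
at low density there are few of them. -/

namespace LocalThinning

/-! ### Moments of the Poisson distribution -/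

lemma lintegral_poissonMeasure (a : ℝ≥0) (f : ℕ → ℝ≥0∞) :
    ∫⁻ n, f n ∂(poissonMeasure a) =
      ∑' n : ℕ, ENNReal.ofReal (Real.exp (-a) * (a : ℝ) ^ n / n.factorial) * f n := by
  simp [poissonMeasure, lintegral_sum_measure, lintegral_smul_measure, lintegral_dirac]

/-- Size biasing of the Poisson distribution: `E[N f(N)] = a E[f(N + 1)]`. -/
lemma lintegral_mul_poissonMeasure (a : ℝ≥0) (f : ℕ → ℝ≥0∞) :
    ∫⁻ n, (n : ℝ≥0∞) * f n ∂(poissonMeasure a) =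
      a * ∫⁻ n, f (n + 1) ∂(poissonMeasure a) := by
  rw [lintegral_poissonMeasure, lintegral_poissonMeasure, tsum_eq_zero_add' ENNReal.summable,
    ← ENNReal.tsum_mul_left]
  simp only [Nat.cast_zero, zero_mul, mul_zero, zero_add]
  refine tsum_congr fun n => ?_
  rw [← ENNReal.ofReal_coe_nnreal, ← ENNReal.ofReal_natCast, ← mul_assoc, ← mul_assoc,
    ← ENNReal.ofReal_mul (by positivity), ← ENNReal.ofReal_mul (by positivity)]
  congr 2
  rw [Nat.factorial_succ]
  push_cast
  field_simp
  ring

/-- Tilting: the series is a constant multiple of the total mass of the Poisson law with parameter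
`a * c`. -/
lemma lintegral_pow_poissonMeasure (a c : ℝ≥0) :
    ∫⁻ n, (c : ℝ≥0∞) ^ n ∂(poissonMeasure a) =
      ENNReal.ofReal (Real.exp ((a : ℝ) * ((c : ℝ) - 1))) := by
  have h1 : ∫⁻ _n : ℕ, 1 ∂(poissonMeasure (a * c)) = 1 := by simp
  rw [lintegral_poissonMeasure] at h1 ⊢
  conv_rhs => rw [← mul_one (ENNReal.ofReal _), ← h1, ← ENNReal.tsum_mul_left]
  refine tsum_congr fun n => ?_
  rw [mul_one, ← ENNReal.ofReal_coe_nnreal, ← ENNReal.ofReal_pow (by positivity),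
    ← ENNReal.ofReal_mul (by positivity), ← ENNReal.ofReal_mul (by positivity)]
  congr 1
  push_cast
  have : Real.exp (-(a : ℝ)) = Real.exp ((a : ℝ) * ((c : ℝ) - 1)) * Real.exp (-((a : ℝ) * c)) := by
    rw [← Real.exp_add]; congr 1; ring
  rw [this]
  ring

/-- Base two is the price of one extra neighbour in `meanWeight_diracSum_le`; this is why moments
are weighted with `2 ^ n`. -/
lemma lintegral_two_pow_poissonMeasure (a : ℝ≥0) :
    ∫⁻ n, (2 : ℝ≥0∞) ^ n ∂(poissonMeasure a) = ENNReal.ofReal (Real.exp a) := by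
  have := lintegral_pow_poissonMeasure a 2
  norm_num at this
  exact this

lemma lintegral_mul_two_pow_poissonMeasure (a : ℝ≥0) :
    ∫⁻ n : ℕ, (n : ℝ≥0∞) * 2 ^ n ∂(poissonMeasure a) =
      2 * a * ENNReal.ofReal (Real.exp a) := by
  rw [lintegral_mul_poissonMeasure]
  simp_rw [pow_succ']
  rw [lintegral_const_mul _ (by fun_prop), lintegral_two_pow_poissonMeasure]
  ring

/-- Size biasing applied twice. The truncated subtraction is harmless, since the factor `n` vanishes
at zero. -/
lemma lintegral_mul_pred_mul_two_pow_poissonMeasure (a : ℝ≥0) :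
    ∫⁻ n : ℕ, (n : ℝ≥0∞) * (((n - 1 : ℕ) : ℝ≥0∞) * 2 ^ n) ∂(poissonMeasure a) =
      4 * a ^ 2 * ENNReal.ofReal (Real.exp a) := by
  rw [lintegral_mul_poissonMeasure]
  have : ∀ n : ℕ, (((n + 1 - 1 : ℕ) : ℝ≥0∞) * 2 ^ (n + 1)) = 2 * ((n : ℝ≥0∞) * 2 ^ n) := by
    intro n; rw [Nat.add_sub_cancel, pow_succ']; ring
  simp_rw [this]
  rw [lintegral_const_mul _ (by fun_prop), lintegral_mul_two_pow_poissonMeasure]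
  ring

/-! ### Finite sums of Dirac masses -/

section DiracSum

variable {E : Type*} [MeasurableSpace E]

/-- The counting measure of a finite list of points. -/
noncomputable def diracSum (l : List E) : Measure E := (l.map Measure.dirac).sum

@[simp] lemma diracSum_nil : diracSum ([] : List E) = 0 := by simp [diracSum]

@[simp] lemma diracSum_cons (x : E) (l : List E) :
    diracSum (x :: l) = Measure.dirac x + diracSum l := by simp [diracSum]

lemma diracSum_append (l l' : List E) : diracSum (l ++ l') = diracSum l + diracSum l' := by
  simp [diracSum]

lemma diracSum_univ (l : List E) : diracSum l Set.univ = l.length := by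
  induction l with
  | nil => simp
  | cons x l ih => simp [ih, add_comm]

instance (l : List E) : IsFiniteMeasure (diracSum l) := ⟨by simp [diracSum_univ]⟩

open Classical in
lemma exists_diracSum_of_finset {ι : Type*} (s : Finset ι) (c : ι → Prop) [DecidablePred c]
    (x : ι → E) :
    ∃ l : List E, (∑ i ∈ s, if c i then Measure.dirac (x i) else 0) = diracSum l := by
  induction s using Finset.induction_on with
  | empty => exact ⟨[], by simp⟩
  | insert i s hi ih =>
    obtain ⟨l, hl⟩ := ih
    rw [Finset.sum_insert hi, hl]
    by_cases h : c i
    · exact ⟨x i :: l, by simp [h]⟩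
    · exact ⟨l, by simp [h]⟩

open Classical in
/-- A sum of Dirac masses that is finite on `B` has only finitely many atoms in `B`. -/
lemma exists_restrict_sum_dirac_eq {c : ℕ → Prop} [DecidablePred c] {x : ℕ → E} {B : Set E}
    (hB : MeasurableSet B)
    (hfin : Measure.sum (fun i => if c i then Measure.dirac (x i) else 0) B ≠ ∞) :
    ∃ n₀, ∀ n ≥ n₀, (Measure.sum (fun i => if c i then Measure.dirac (x i) else 0)).restrict B =
      ∑ i ∈ Finset.range n, if c i ∧ x i ∈ B then Measure.dirac (x i) else 0 := by
  have hterm : ∀ i, (if c i then Measure.dirac (x i) else 0 : Measure E).restrict B =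
      if c i ∧ x i ∈ B then Measure.dirac (x i) else 0 := by
    intro i
    by_cases h : c i
    · simp only [h, if_true, true_and]
      exact restrict_dirac' hB
    · simp [h]
  have hset : {i | c i ∧ x i ∈ B}.Finite := by
    rw [Measure.sum_apply _ hB] at hfin
    refine (ENNReal.finite_const_le_of_tsum_ne_top hfin one_ne_zero).subset ?_
    rintro i ⟨h1, h2⟩
    simp [h1, Measure.dirac_apply' _ hB, h2]
  obtain ⟨n₀, hn₀⟩ := hset.bddAbove
  refine ⟨n₀ + 1, fun n hn => ?_⟩
  rw [Measure.restrict_sum _ hB]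
  simp_rw [hterm]
  ext s hs
  rw [Measure.sum_apply _ hs, Measure.finsetSum_apply, tsum_eq_sum]
  intro i hi
  have : ¬ (c i ∧ x i ∈ B) := fun h => by
    have := hn₀ h
    simp at hi
    omega
  simp [this]

end DiracSum

/-! ### Counts and restrictions of a Poisson process -/

section Poisson

variable {d : ℕ} {Ω : Type*} [MeasurableSpace Ω] {P : Measure Ω}
  {X : Ω → Measure (Space d)} {Λ : Measure (Space d)}

/-- The number of points of a configuration in the set `B`. -/
noncomputable def count (ν : Measure (Space d)) (B : Set (Space d)) : ℕ := ⌊(ν B).toReal⌋₊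

lemma measurable_count (hX : Measurable X) {B : Set (Space d)} (hB : MeasurableSet B) :
    Measurable (fun ω => count (X ω) B) :=
  Nat.measurable_floor.comp ((Measure.measurable_coe hB).comp hX).ennreal_toReal

lemma IsPointProcess.coe_count (hX : IsPointProcess X) {B : Set (Space d)}
    (hB : MeasurableSet B) (hb : Bornology.IsBounded B) (ω : Ω) :
    (count (X ω) B : ℝ≥0∞) = X ω B := by
  obtain ⟨n, hn⟩ := hX.counting ω B hB hb
  simp [count, hn]

lemma IsPoissonProcess.hasLaw_count (hX : IsPoissonProcess P X Λ) {B : Set (Space d)}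
    (hB : MeasurableSet B) (hb : Bornology.IsBounded B) :
    HasLaw (fun ω => count (X ω) B) (poissonMeasure (Λ B).toNNReal) P := by
  have hm : Measurable (fun t : ℝ≥0∞ => ⌊t.toReal⌋₊) :=
    Nat.measurable_floor.comp ENNReal.measurable_toReal
  refine ⟨(measurable_count hX.isPointProcess.measurable hB).aemeasurable, ?_⟩
  have h := (hX.count_law B hB hb).map_eq
  have : (fun ω => count (X ω) B) = (fun t : ℝ≥0∞ => ⌊t.toReal⌋₊) ∘ (fun ω => X ω B) := rfl
  rw [this, ← Measure.map_map hm
    (show Measurable fun ω => X ω B from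
      (Measure.measurable_coe hB).comp hX.isPointProcess.measurable), h, Measure.map_map hm (by fun_prop)]
  convert! Measure.map_id
  ext n
  simp

lemma IsPoissonProcess.lintegral_count (hX : IsPoissonProcess P X Λ) {B : Set (Space d)}
    (hB : MeasurableSet B) (hb : Bornology.IsBounded B) (f : ℕ → ℝ≥0∞) :
    ∫⁻ ω, f (count (X ω) B) ∂P = ∫⁻ n, f n ∂(poissonMeasure (Λ B).toNNReal) :=
  (hX.hasLaw_count hB hb).lintegral_comp (by fun_prop)

lemma lintegral_two_pow_count (hX : IsPoissonProcess P X Λ) {B : Set (Space d)}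
    (hB : MeasurableSet B) (hb : Bornology.IsBounded B) :
    ∫⁻ ω, 2 ^ count (X ω) B ∂P = ENNReal.ofReal (Real.exp (Λ B).toReal) := by
  rw [hX.lintegral_count hB hb (fun n => 2 ^ n), lintegral_two_pow_poissonMeasure]
  simp [ENNReal.coe_toNNReal_eq_toReal]

lemma IsPoissonProcess.measure_count_eq_zero (hX : IsPoissonProcess P X Λ) {B : Set (Space d)}
    (hB : MeasurableSet B) (hb : Bornology.IsBounded B) :
    P {ω | count (X ω) B = 0} = ENNReal.ofReal (Real.exp (-(Λ B).toReal)) := by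
  have := (hX.hasLaw_count hB hb).measure_eq (p := fun n => n = 0) (.of_discrete)
  rw [this, Set.ofPred_eq_eq_singleton, poissonMeasure_singleton]
  simp [ENNReal.coe_toNNReal_eq_toReal]

lemma measurable_restrict_of_measurable (hX : Measurable X) {B : Set (Space d)}
    (hB : MeasurableSet B) : Measurable (fun ω => (X ω).restrict B) :=
  Measure.measurable_of_measurable_coe _ fun s hs => by
    simp_rw [Measure.restrict_apply hs]
    exact (Measure.measurable_coe (hs.inter hB)).comp hX

open Classical in
/-- The restrictions of a Poisson process to disjoint bounded sets are independent. -/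
lemma IsPoissonProcess.indepFun_restrict [IsProbabilityMeasure P] (hX : IsPoissonProcess P X Λ)
    {A B : Set (Space d)} (hA : MeasurableSet A) (hB : MeasurableSet B)
    (hbA : Bornology.IsBounded A) (hbB : Bornology.IsBounded B) (hAB : Disjoint A B) :
    IndepFun (fun ω => (X ω).restrict A) (fun ω => (X ω).restrict B) P := by
  let S := {C : Set (Space d) // MeasurableSet C}
  have hmeas : ∀ {C : Set (Space d)}, MeasurableSet C → Measurable (fun ω => X ω C) :=
    fun hC => (Measure.measurable_coe hC).comp hX.isPointProcess.measurable
  have hproc : IndepFun (fun ω (C : S) => X ω (C.1 ∩ A)) (fun ω (C : S) => X ω (C.1 ∩ B)) P := by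
    refine IndepFun.process_indepFun_process (X := fun (C : S) ω => X ω (C.1 ∩ A))
      (Y := fun (C : S) ω => X ω (C.1 ∩ B)) (fun C => hmeas (C.2.inter hA))
      (fun C => hmeas (C.2.inter hB)) fun I J => ?_
    -- The sets in `K` may overlap, whereas independence is given for disjoint sets only. So the
    -- space is cut into the atoms of the finite algebra generated by `K`, each intersected with `A`
    -- or with `B`; the counts of interest are sums over disjoint groups of atoms.
    let K : Finset S := I ∪ J
    let ψ : Space d → (K → Bool) := fun x k => decide (x ∈ k.1.1)
    have hψ : ∀ σ, MeasurableSet (ψ ⁻¹' {σ}) := by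
      intro σ
      have : ψ ⁻¹' {σ} = ⋂ k : K, {x | x ∈ k.1.1 ↔ σ k = true} := by
        ext x
        simp only [Set.mem_preimage, Set.mem_singleton_iff, Set.mem_iInter, Set.mem_ofPred_eq, ψ,
          funext_iff]
        refine forall_congr' fun k => ?_
        cases σ k <;> simp
      rw [this]
      refine MeasurableSet.iInter fun k => ?_
      cases h : σ k
      · have h1 : {x : Space d | x ∈ k.1.1 ↔ false = true} = k.1.1ᶜ := by ext x; simp
        rw [h1]
        exact k.1.2.compl
      · have h1 : {x : Space d | x ∈ k.1.1 ↔ true = true} = k.1.1 := by ext x; simp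
        rw [h1]
        exact k.1.2
    let atom : Bool × (K → Bool) → Set (Space d) :=
      fun q => ψ ⁻¹' {q.2} ∩ (if q.1 then A else B)
    have hatom : ∀ q, MeasurableSet (atom q) := by
      rintro ⟨b, σ⟩
      cases b
      · exact (hψ σ).inter hB
      · exact (hψ σ).inter hA
    have hbatom : ∀ q, Bornology.IsBounded (atom q) := by
      rintro ⟨b, σ⟩
      cases b
      · exact hbB.subset Set.inter_subset_right
      · exact hbA.subset Set.inter_subset_right
    have hdisj : ∀ q q', q ≠ q' → Disjoint (atom q) (atom q') := by
      rintro ⟨b, σ⟩ ⟨b', σ'⟩ hne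
      rw [Set.disjoint_left]
      rintro x ⟨hx1, hx2⟩ ⟨hx3, hx4⟩
      simp only [Set.mem_preimage, Set.mem_singleton_iff] at hx1 hx3
      have hσ : σ = σ' := hx1.symm.trans hx3
      subst hσ
      have hAB' := Set.disjoint_left.1 hAB
      cases b <;> cases b' <;> simp_all
    have hind : iIndepFun (fun q ω => X ω (atom q)) P := by
      let e := Fintype.equivFin (Bool × (K → Bool))
      have h := hX.count_indep _ (fun i => atom (e.symm i)) (fun i => hatom _)
        (fun i => hbatom _) (fun i j hij => hdisj _ _ (by simpa using hij))
      simpa using h.precomp e.injective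
    let T1 : Finset (Bool × (K → Bool)) := Finset.univ.filter (fun q => q.1 = true)
    let T2 : Finset (Bool × (K → Bool)) := Finset.univ.filter (fun q => q.1 = false)
    have hT : Disjoint T1 T2 := by
      rw [Finset.disjoint_left]
      simp [T1, T2]
    have h2 := hind.indepFun_finset T1 T2 hT (fun q => hmeas (hatom q))
    have hsum : ∀ (b : Bool) (k : K) (ω : Ω), X ω (k.1.1 ∩ (if b then A else B)) =
        ∑ σ ∈ Finset.univ.filter (fun σ : K → Bool => σ k = true), X ω (atom (b, σ)) := by
      intro b k ω
      rw [← measure_biUnion_finset]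
      · congr 1
        ext x
        simp [atom, ψ]
      · intro σ _ σ' _ hne
        exact hdisj _ _ (by simpa using hne)
      · exact fun σ _ => hatom _
    have h3 := h2.comp
      (φ := fun (f : T1 → ℝ≥0∞) (i : I) =>
        ∑ σ ∈ Finset.univ.filter
          (fun σ : K → Bool => σ ⟨i.1, Finset.mem_union_left _ i.2⟩ = true),
          f ⟨(true, σ), by simp [T1]⟩)
      (ψ := fun (f : T2 → ℝ≥0∞) (j : J) =>
        ∑ σ ∈ Finset.univ.filter
          (fun σ : K → Bool => σ ⟨j.1, Finset.mem_union_right _ j.2⟩ = true),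
          f ⟨(false, σ), by simp [T2]⟩)
      (by fun_prop) (by fun_prop)
    convert! h3 using 1
    · ext ω i
      exact hsum true ⟨i.1, Finset.mem_union_left _ i.2⟩ ω
    · ext ω j
      exact hsum false ⟨j.1, Finset.mem_union_right _ j.2⟩ ω
  -- The σ-algebra on measures is generated by evaluations, so independence of the families of
  -- counts is enough.
  have hcomap : ∀ {D : Set (Space d)}, MeasurableSet D →
      MeasurableSpace.comap (fun ω => (X ω).restrict D) inferInstance ≤
        MeasurableSpace.comap (fun ω (C : S) => X ω (C.1 ∩ D)) inferInstance := by
    intro D hD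
    rw [← measurable_iff_comap_le]
    refine @Measure.measurable_of_measurable_coe _ _ _ (_) _ fun s hs => ?_
    simp_rw [Measure.restrict_apply hs]
    have h1 : Measurable[MeasurableSpace.comap (fun ω (C : S) => X ω (C.1 ∩ D)) inferInstance]
        (fun ω (C : S) => X ω (C.1 ∩ D)) := comap_measurable _
    exact (measurable_pi_apply (⟨s, hs⟩ : S)).comp h1
  rw [IndepFun_iff_Indep] at hproc ⊢
  exact indep_of_indep_of_le_left (indep_of_indep_of_le_right hproc (hcomap hB)) (hcomap hA)

end Poisson

/-! ### Measurability of integrals against finite random measures -/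

section FiniteKernels

variable {α E : Type*} [MeasurableSpace α] [MeasurableSpace E]

/-- The masses need not be uniformly bounded, so the kernel is sliced according to the integer part
of its total mass. S-finiteness is what makes integrals against a random configuration measurable.
-/
lemma isSFiniteKernel_of_isFiniteMeasure (κ : Kernel α E) (h : ∀ a, IsFiniteMeasure (κ a)) :
    IsSFiniteKernel κ := by
  classical
  let s : ℕ → Set α := fun n => {a | ⌊(κ a Set.univ).toReal⌋₊ = n}
  have hs : ∀ n, MeasurableSet (s n) := fun n =>
    (Nat.measurable_floor.comp (κ.measurable_coe MeasurableSet.univ).ennreal_toReal)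
      (measurableSet_singleton n)
  refine ⟨⟨fun n => Kernel.piecewise (hs n) κ 0, fun n => ⟨⟨(n + 1 : ℕ), by simp, fun a => ?_⟩⟩, ?_⟩⟩
  · rw [Kernel.piecewise_apply]
    split_ifs with ha
    · rw [← ENNReal.ofReal_toReal (measure_ne_top (κ a) Set.univ), ← ENNReal.ofReal_natCast]
      refine ENNReal.ofReal_le_ofReal ?_
      have h2 : ⌊(κ a Set.univ).toReal⌋₊ = n := ha
      have := Nat.lt_floor_add_one (κ a Set.univ).toReal
      rw [h2] at this
      push_cast
      exact this.le
    · simp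
  · ext a t ht
    rw [Kernel.sum_apply' _ _ ht, tsum_eq_single ⌊(κ a Set.univ).toReal⌋₊]
    · rw [Kernel.piecewise_apply, if_pos]
      exact rfl
    · intro n hn
      rw [Kernel.piecewise_apply, if_neg]
      · simp
      · exact fun h => hn h.symm

open Classical in
/-- The measure `ν` if it is finite, and zero otherwise. -/
noncomputable def truncate (ν : Measure E) : Measure E := if ν Set.univ < ∞ then ν else 0

instance (ν : Measure E) : IsFiniteMeasure (truncate ν) := by
  unfold truncate
  split_ifs with h
  · exact ⟨h⟩
  · infer_instance

@[simp] lemma truncate_of_isFiniteMeasure (ν : Measure E) [IsFiniteMeasure ν] :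
    truncate ν = ν := by
  simp [truncate]

/-- Functionals such as `weight` are shown to be measurable only along families of finite measures.
Composing with `truncate` gives genuinely measurable functions on all measures without changing
their values at finite ones. -/
lemma measurable_truncate : Measurable (truncate : Measure E → Measure E) :=
  Measurable.ite (measurableSet_lt (Measure.measurable_coe MeasurableSet.univ) measurable_const)
    measurable_id measurable_const

lemma measurable_measure_add {f e : α → Measure E} (hf : Measurable f) (he : Measurable e) :
    Measurable (fun a => f a + e a) :=
  Measure.measurable_of_measurable_coe _ fun s hs => by
    simp only [Measure.add_apply]
    exact ((Measure.measurable_coe hs).comp hf).add ((Measure.measurable_coe hs).comp he)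

/-- Expectation of a function of two independent random variables. -/
lemma lintegral_prod_of_indepFun {Ω β : Type*} [MeasurableSpace Ω] [MeasurableSpace β]
    {P : Measure Ω} [IsProbabilityMeasure P] {S : Ω → α} {T : Ω → β} (hS : Measurable S)
    (hT : Measurable T) (hind : IndepFun S T P) {F : α × β → ℝ≥0∞} (hF : Measurable F) :
    ∫⁻ ω, F (S ω, T ω) ∂P = ∫⁻ ω, ∫⁻ ω', F (S ω, T ω') ∂P ∂P := by
  have h2 := (indepFun_iff_map_prod_eq_prod_map_map hS.aemeasurable hT.aemeasurable).1 hind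
  have : IsProbabilityMeasure (P.map T) := Measure.isProbabilityMeasure_map hT.aemeasurable
  calc ∫⁻ ω, F (S ω, T ω) ∂P = ∫⁻ q, F q ∂(P.map fun ω => (S ω, T ω)) :=
        (lintegral_map hF (hS.prodMk hT)).symm
    _ = ∫⁻ s, ∫⁻ t, F (s, t) ∂(P.map T) ∂(P.map S) := by
        rw [h2, lintegral_prod _ hF.aemeasurable]
    _ = _ := by
        rw [lintegral_map hF.lintegral_prod_right' hS]
        refine lintegral_congr fun ω => ?_
        exact lintegral_map (hF.comp (measurable_const.prodMk measurable_id)) hT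

/-- Expectation of a functional of two independent finite random measures. -/
lemma lintegral_of_indepFun {Ω : Type*} [MeasurableSpace Ω] {P : Measure Ω}
    [IsProbabilityMeasure P] {S T : Ω → Measure E} (hS : Measurable S) (hT : Measurable T)
    (hfS : ∀ ω, IsFiniteMeasure (S ω)) (hfT : ∀ ω, IsFiniteMeasure (T ω))
    (hind : IndepFun S T P) {F : Measure E → Measure E → ℝ≥0∞}
    (hF : Measurable fun q : Measure E × Measure E => F (truncate q.1) (truncate q.2)) :
    ∫⁻ ω, F (S ω) (T ω) ∂P = ∫⁻ ω, ∫⁻ ω', F (S ω) (T ω') ∂P ∂P := by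
  have h1 : ∀ ω ω', F (S ω) (T ω') = F (truncate (S ω)) (truncate (T ω')) := fun ω ω' => by
    have := hfS ω
    have := hfT ω'
    simp
  simp_rw [h1]
  exact lintegral_prod_of_indepFun hS hT hind hF

end FiniteKernels

/-! ### The weight of a configuration -/

section Weight

variable {d : ℕ} {r : ℝ} {p : ℕ → ℝ} {g : Space d → ℝ} {M : ℝ}

/-- `-log` of the conditional mean of `exp(-g(y) 1{y is retained})` for a point `y` that has `m`
neighbours. -/
noncomputable def rate (p : ℕ → ℝ) (g : Space d → ℝ) (y : Space d) (m : ℕ) : ℝ :=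
  -Real.log (1 - (1 - Real.exp (-g y)) * p m)

/-- Retention has probability at most one. The bound keeps the argument of the logarithm in `rate`
positive and yields `rate_le`. -/
lemma exp_neg_le_one_sub (hp : ∀ n, p n ∈ Set.Icc (0 : ℝ) 1) (hg : ∀ y, 0 ≤ g y)
    (y : Space d) (m : ℕ) :
    Real.exp (-g y) ≤ 1 - (1 - Real.exp (-g y)) * p m := by
  have h1 : Real.exp (-g y) ≤ 1 := Real.exp_le_one_iff.2 (by linarith [hg y])
  nlinarith [(hp m).1, (hp m).2]

lemma exp_neg_rate (hp : ∀ n, p n ∈ Set.Icc (0 : ℝ) 1) (hg : ∀ y, 0 ≤ g y)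
    (y : Space d) (m : ℕ) :
    Real.exp (-rate p g y m) = 1 - (1 - Real.exp (-g y)) * p m := by
  rw [rate, neg_neg, Real.exp_log]
  exact (Real.exp_pos _).trans_le (exp_neg_le_one_sub hp hg y m)

lemma rate_le (hp : ∀ n, p n ∈ Set.Icc (0 : ℝ) 1) (hg : ∀ y, 0 ≤ g y) (y : Space d) (m : ℕ) :
    rate p g y m ≤ g y := by
  have := exp_neg_le_one_sub hp hg y m
  rw [← exp_neg_rate hp hg, Real.exp_le_exp] at this
  linarith

lemma rate_nonneg (hp : ∀ n, p n ∈ Set.Icc (0 : ℝ) 1) (hg : ∀ y, 0 ≤ g y) (y : Space d) (m : ℕ) :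
    0 ≤ rate p g y m := by
  have h1 : Real.exp (-g y) ≤ 1 := Real.exp_le_one_iff.2 (by linarith [hg y])
  have h2 : Real.exp (-rate p g y m) ≤ 1 := by
    rw [exp_neg_rate hp hg]
    nlinarith [(hp m).1]
  linarith [Real.exp_le_one_iff.1 h2]

lemma rate_eq_zero {y : Space d} (h : g y = 0) (m : ℕ) : rate p g y m = 0 := by
  simp [rate, h]

lemma measurable_rate (hg : Measurable g) :
    Measurable (fun q : Space d × ℕ => rate p g q.1 q.2) := by
  have : Measurable p := .of_discrete
  unfold rate
  fun_prop

/-- The punctured balls are the sections of one measurable set of pairs of points, so kernel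
measurability applies jointly in the configuration and the centre. -/
lemma measurable_neighbourCount {α : Type*} [MeasurableSpace α] {f : α → Measure (Space d)}
    (hf : Measurable f) (hfin : ∀ a, IsFiniteMeasure (f a)) :
    Measurable (fun q : α × Space d => neighbourCount r q.2 (f q.1)) := by
  let κ : Kernel α (Space d) := ⟨f, hf⟩
  have : IsSFiniteKernel κ := isSFiniteKernel_of_isFiniteMeasure κ hfin
  let t : Set ((α × Space d) × Space d) := {q | dist q.2 q.1.2 ≤ r ∧ q.2 ≠ q.1.2}
  have ht : MeasurableSet t := by
    have h1 : Measurable fun q : (α × Space d) × Space d => q.1.2 := by fun_prop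
    exact (measurableSet_le (measurable_snd.dist h1) measurable_const).inter
      (measurableSet_eq_fun measurable_snd h1).compl
  have h := Kernel.measurable_kernel_prodMk_left (κ := Kernel.prodMkRight (Space d) κ) ht
  refine Nat.measurable_floor.comp (Measurable.ennreal_toReal ?_)
  convert! h using 2

lemma measurable_neighbourCount_right (ν : Measure (Space d)) [IsFiniteMeasure ν] :
    Measurable (fun y => neighbourCount r y ν) := by
  have h := measurable_neighbourCount (r := r) (f := fun _ : Unit => ν) measurable_const
    (fun _ => inferInstance)
  have h2 : Measurable (fun y : Space d => ((), y)) := measurable_prodMk_left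
  simpa only [Function.comp_def] using h.comp h2

/-- The total rate of the points of `ν`, with neighbours counted in `ν + η`. -/
noncomputable def energy (r : ℝ) (p : ℕ → ℝ) (g : Space d → ℝ) (ν η : Measure (Space d)) : ℝ :=
  ∫ y, rate p g y (neighbourCount r y (ν + η)) ∂ν

/-- The conditional expectation of `exp(-∑ g)` over the retained points of `ν`, when the
retention of a point depends on its neighbours in `ν + η`. -/
noncomputable def weight (r : ℝ) (p : ℕ → ℝ) (g : Space d → ℝ) (ν η : Measure (Space d)) :
    ℝ≥0∞ :=
  ENNReal.ofReal (Real.exp (-energy r p g ν η))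

lemma measurable_weight {α : Type*} [MeasurableSpace α] (hg : Measurable g)
    {f e : α → Measure (Space d)} (hf : Measurable f) (he : Measurable e)
    (hff : ∀ a, IsFiniteMeasure (f a)) (hfe : ∀ a, IsFiniteMeasure (e a)) :
    Measurable (fun a => weight r p g (f a) (e a)) := by
  let κ : Kernel α (Space d) := ⟨f, hf⟩
  have : IsSFiniteKernel κ := isSFiniteKernel_of_isFiniteMeasure κ hff
  refine ENNReal.measurable_ofReal.comp (Real.measurable_exp.comp (Measurable.neg ?_))
  refine (StronglyMeasurable.integral_kernel_prod_right (κ := κ)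
    (f := fun a y => rate p g y (neighbourCount r y (f a + e a)))
    (Measurable.stronglyMeasurable ?_)).measurable
  exact (measurable_rate hg).comp (measurable_snd.prodMk
    (measurable_neighbourCount (measurable_measure_add hf he) fun a => by
      have := hff a
      have := hfe a
      infer_instance))

lemma integrable_rate (hp : ∀ n, p n ∈ Set.Icc (0 : ℝ) 1) (hgm : Measurable g)
    (hg : ∀ y, 0 ≤ g y) (hgM : ∀ y, g y ≤ M) (ν ρ : Measure (Space d)) [IsFiniteMeasure ν] [IsFiniteMeasure ρ] :
    Integrable (fun y => rate p g y (neighbourCount r y ρ)) ν := by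
  refine Integrable.of_bound (C := M) ?_ (ae_of_all _ fun y => ?_)
  · exact ((measurable_rate hgm).comp
      (measurable_id.prodMk (measurable_neighbourCount_right ρ))).aestronglyMeasurable
  · rw [Real.norm_eq_abs, abs_of_nonneg (rate_nonneg hp hg _ _)]
    exact (rate_le hp hg _ _).trans (hgM y)

lemma energy_nonneg (hp : ∀ n, p n ∈ Set.Icc (0 : ℝ) 1) (hg : ∀ y, 0 ≤ g y)
    (ν η : Measure (Space d)) : 0 ≤ energy r p g ν η :=
  integral_nonneg fun _ => rate_nonneg hp hg _ _

lemma weight_le_one (hp : ∀ n, p n ∈ Set.Icc (0 : ℝ) 1) (hg : ∀ y, 0 ≤ g y)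
    (ν η : Measure (Space d)) : weight r p g ν η ≤ 1 := by
  rw [weight, ← ENNReal.ofReal_one]
  refine ENNReal.ofReal_le_ofReal (Real.exp_le_one_iff.2 ?_)
  linarith [energy_nonneg (r := r) hp hg ν η]

@[simp] lemma weight_zero_left (η : Measure (Space d)) : weight r p g 0 η = 1 := by
  simp [weight, energy]

/-- Forgetting the points in `C`, other than as neighbours, increases the weight. -/
lemma weight_le_weight_restrict (hp : ∀ n, p n ∈ Set.Icc (0 : ℝ) 1) (hgm : Measurable g)
    (hg : ∀ y, 0 ≤ g y) (hgM : ∀ y, g y ≤ M) {C : Set (Space d)} (hC : MeasurableSet C)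
    (ν η : Measure (Space d)) [IsFiniteMeasure ν] [IsFiniteMeasure η] :
    weight r p g ν η ≤ weight r p g (ν.restrict Cᶜ) (ν.restrict C + η) := by
  refine ENNReal.ofReal_le_ofReal (Real.exp_le_exp.2 (neg_le_neg ?_))
  have h : ν.restrict Cᶜ + (ν.restrict C + η) = ν + η := by
    rw [← add_assoc, add_comm (ν.restrict Cᶜ), Measure.restrict_add_restrict_compl hC]
  rw [energy, energy, h]
  exact setIntegral_le_integral (integrable_rate hp hgm hg hgM ν (ν + η))
    (ae_of_all _ fun _ => rate_nonneg hp hg _ _)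

lemma neighbourCount_add_of_eq_zero {y : Space d} {ρ σ : Measure (Space d)}
    (h : σ (Metric.closedBall y r) = 0) :
    neighbourCount r y (ρ + σ) = neighbourCount r y ρ := by
  have : σ (Metric.closedBall y r \ {y}) = 0 := measure_mono_null Set.sdiff_subset h
  simp [neighbourCount, this]

/-- Extra neighbours at distance more than `r` from the points of `ν` do not matter. -/
lemma weight_add_right_of_far {ν η σ : Measure (Space d)} {C : Set (Space d)}
    (hC : ν C = 0) (hσ : ∀ y ∉ C, g y ≠ 0 → σ (Metric.closedBall y r) = 0) :
    weight r p g ν (σ + η) = weight r p g ν η := by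
  have h : energy r p g ν (σ + η) = energy r p g ν η := by
    refine integral_congr_ae ?_
    filter_upwards [measure_eq_zero_iff_ae_notMem.1 hC] with y hy
    by_cases hgy : g y = 0
    · rw [rate_eq_zero hgy, rate_eq_zero hgy]
    · rw [add_comm σ, ← add_assoc, neighbourCount_add_of_eq_zero (hσ y hy hgy)]
  rw [weight, weight, h]

end Weight

/-! ### The effect of extra neighbours on the mean weight -/

section MeanWeight

variable {d : ℕ} {Ω : Type*} {X : Ω → Measure (Space d)} {Λ : Measure (Space d)}
  {r : ℝ} {p : ℕ → ℝ} {g : Space d → ℝ} {M : ℝ}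

/-- `X` is, on bounded sets, a finite sum of Dirac masses. -/
def IsLocallyDiracSum (X : Ω → Measure (Space d)) : Prop :=
  ∀ ω, ∀ B : Set (Space d), MeasurableSet B → Bornology.IsBounded B →
    ∃ l : List (Space d), (X ω).restrict B = diracSum l

lemma IsLocallyDiracSum.isFiniteMeasure_restrict (hL : IsLocallyDiracSum X) {B : Set (Space d)}
    (hB : MeasurableSet B) (hb : Bornology.IsBounded B) (ω : Ω) :
    IsFiniteMeasure ((X ω).restrict B) := by
  obtain ⟨l, hl⟩ := hL ω B hB hb
  rw [hl]
  infer_instance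

variable [MeasurableSpace Ω] {P : Measure Ω}

/-- The mean weight of the part of `X` in `C`, with additional neighbours `η`. -/
noncomputable def meanWeight (P : Measure Ω) (X : Ω → Measure (Space d)) (r : ℝ) (p : ℕ → ℝ)
    (g : Space d → ℝ) (C : Set (Space d)) (η : Measure (Space d)) : ℝ≥0∞ :=
  ∫⁻ ω, weight r p g ((X ω).restrict C) η ∂P

lemma length_eq_count {B : Set (Space d)} {ν : Measure (Space d)} {l : List (Space d)}
    (hl : ν.restrict B = diracSum l) : l.length = count ν B := by
  have : ν B = l.length := by
    rw [← diracSum_univ l, ← hl, Measure.restrict_apply_univ]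
  simp [count, this]

lemma count_restrict_univ (ν : Measure (Space d)) (B : Set (Space d)) :
    count (ν.restrict B) Set.univ = count ν B := by
  simp [count]

lemma measurable_comp_restrict (hX : Measurable X) (hL : IsLocallyDiracSum X)
    {A : Set (Space d)} (hA : MeasurableSet A) (hbA : Bornology.IsBounded A)
    {f : Measure (Space d) → ℝ≥0∞} (hf : Measurable fun ν => f (truncate ν)) :
    Measurable fun ω => f ((X ω).restrict A) := by
  have h := hf.comp (measurable_restrict_of_measurable hX hA)
  have h2 : ∀ ω, truncate ((X ω).restrict A) = (X ω).restrict A := fun ω => by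
    have := hL.isFiniteMeasure_restrict hA hbA ω
    simp
  simpa only [Function.comp_def, h2] using h

variable [IsProbabilityMeasure P]

lemma meanWeight_le_one (hp : ∀ n, p n ∈ Set.Icc (0 : ℝ) 1)
    (hg : ∀ y, 0 ≤ g y) (C : Set (Space d)) (η : Measure (Space d)) :
    meanWeight P X r p g C η ≤ 1 := by
  calc meanWeight P X r p g C η ≤ ∫⁻ _, 1 ∂P := lintegral_mono fun ω => weight_le_one hp hg _ _
    _ = 1 := by simp

/-- Expectation of a functional of the parts of `X` in two disjoint sets. -/
lemma lintegral_restrict_of_disjoint (hX : IsPoissonProcess P X Λ) (hL : IsLocallyDiracSum X)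
    {A C : Set (Space d)} (hA : MeasurableSet A) (hC : MeasurableSet C)
    (hbA : Bornology.IsBounded A) (hbC : Bornology.IsBounded C) (hAC : Disjoint A C)
    {F : Measure (Space d) → Measure (Space d) → ℝ≥0∞}
    (hF : Measurable fun q : Measure (Space d) × Measure (Space d) =>
      F (truncate q.1) (truncate q.2)) :
    ∫⁻ ω, F ((X ω).restrict A) ((X ω).restrict C) ∂P =
      ∫⁻ ω, ∫⁻ ω', F ((X ω).restrict A) ((X ω').restrict C) ∂P ∂P :=
  lintegral_of_indepFun (measurable_restrict_of_measurable hX.isPointProcess.measurable hA)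
    (measurable_restrict_of_measurable hX.isPointProcess.measurable hC)
    (hL.isFiniteMeasure_restrict hA hbA) (hL.isFiniteMeasure_restrict hC hbC)
    (hX.indepFun_restrict hA hC hbA hbC hAC) hF

/-- By independence the points in `A` can be frozen while those in `C` are averaged. The frozen
points then join `l` as extra neighbours, and `hK` charges a factor two for each of them. -/
lemma lintegral_mul_weight_le (hX : IsPoissonProcess P X Λ) (hL : IsLocallyDiracSum X)
    (hgm : Measurable g)
    {A C : Set (Space d)} (hA : MeasurableSet A) (hC : MeasurableSet C)
    (hbA : Bornology.IsBounded A) (hbC : Bornology.IsBounded C) (hAC : Disjoint A C)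
    {f : Measure (Space d) → ℝ≥0∞} (hf : Measurable fun ν => f (truncate ν)) {K : ℝ≥0∞}
    (hK : ∀ l, meanWeight P X r p g C (diracSum l) ≤ K * 2 ^ l.length * meanWeight P X r p g C 0)
    (l : List (Space d)) :
    ∫⁻ ω, f ((X ω).restrict A) * weight r p g ((X ω).restrict C) ((X ω).restrict A + diracSum l) ∂P
      ≤ (∫⁻ ω, f ((X ω).restrict A) * 2 ^ count (X ω) A ∂P) *
        (K * 2 ^ l.length * meanWeight P X r p g C 0) := by
  have hw : Measurable fun q : Measure (Space d) × Measure (Space d) =>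
      weight r p g (truncate q.2) (truncate q.1 + diracSum l) :=
    measurable_weight hgm (measurable_truncate.comp measurable_snd)
      (measurable_measure_add (measurable_truncate.comp measurable_fst) measurable_const)
      (fun _ => inferInstance) (fun _ => inferInstance)
  have hfA := measurable_comp_restrict hX.isPointProcess.measurable hL hA hbA hf
  rw [lintegral_restrict_of_disjoint hX hL hA hC hbA hbC hAC
    (F := fun s t => f s * weight r p g t (s + diracSum l))
    ((hf.comp measurable_fst).mul hw)]
  have hm : Measurable fun ω => f ((X ω).restrict A) * 2 ^ count (X ω) A :=
    hfA.mul ((measurable_count hX.isPointProcess.measurable hA).const_pow 2)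
  rw [← lintegral_mul_const _ hm]
  refine lintegral_mono fun ω => ?_
  have := hL.isFiniteMeasure_restrict hA hbA ω
  obtain ⟨l', hl'⟩ := hL ω A hA hbA
  have hlen := length_eq_count hl'
  calc ∫⁻ ω', f ((X ω).restrict A) *
        weight r p g ((X ω').restrict C) ((X ω).restrict A + diracSum l) ∂P
      = f ((X ω).restrict A) * meanWeight P X r p g C (diracSum (l' ++ l)) := by
        rw [meanWeight, diracSum_append, ← hl', lintegral_const_mul]
        exact measurable_weight hgm
          (measurable_restrict_of_measurable hX.isPointProcess.measurable hC) measurable_const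
          (hL.isFiniteMeasure_restrict hC hbC) (fun _ => inferInstance)
    _ ≤ f ((X ω).restrict A) * (K * 2 ^ (l' ++ l).length * meanWeight P X r p g C 0) := by
        gcongr
        exact hK _
    _ = _ := by
        rw [List.length_append, hlen, pow_add]
        ring

/-- Here the points in `A` are not seen as neighbours by those in `C`, so the expectation factorises
exactly. -/
lemma lintegral_mul_weight_eq (hX : IsPoissonProcess P X Λ) (hL : IsLocallyDiracSum X)
    (hgm : Measurable g) {A C : Set (Space d)} (hA : MeasurableSet A) (hC : MeasurableSet C)
    (hbA : Bornology.IsBounded A) (hbC : Bornology.IsBounded C) (hAC : Disjoint A C)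
    {f : Measure (Space d) → ℝ≥0∞} (hf : Measurable fun ν => f (truncate ν)) :
    ∫⁻ ω, f ((X ω).restrict A) * weight r p g ((X ω).restrict C) 0 ∂P =
      (∫⁻ ω, f ((X ω).restrict A) ∂P) * meanWeight P X r p g C 0 := by
  have hw : Measurable fun q : Measure (Space d) × Measure (Space d) =>
      weight r p g (truncate q.2) 0 :=
    measurable_weight hgm (measurable_truncate.comp measurable_snd) measurable_const
      (fun _ => inferInstance) (fun _ => inferInstance)
  rw [lintegral_restrict_of_disjoint hX hL hA hC hbA hbC hAC
    (F := fun s t => f s * weight r p g t 0) ((hf.comp measurable_fst).mul hw),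
    ← lintegral_mul_const _ (measurable_comp_restrict hX.isPointProcess.measurable hL hA hbA hf)]
  refine lintegral_congr fun ω => ?_
  rw [meanWeight, lintegral_const_mul]
  exact measurable_weight hgm
    (measurable_restrict_of_measurable hX.isPointProcess.measurable hC) measurable_const
    (hL.isFiniteMeasure_restrict hC hbC) (fun _ => inferInstance)

lemma restrict_eq_restrict_sdiff {ν : Measure (Space d)} {A C : Set (Space d)}
    (hA : MeasurableSet A) (h : ν (C ∩ A) = 0) : ν.restrict C = ν.restrict (C \ A) := by
  rw [← Measure.restrict_inter_add_sdiff C hA, Measure.restrict_eq_zero.2 h, zero_add]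

/-- Conditioning on the absence of points in `A`. -/
lemma meanWeight_sdiff_le (hX : IsPoissonProcess P X Λ) (hL : IsLocallyDiracSum X)
    (hgm : Measurable g) {A C : Set (Space d)} (hA : MeasurableSet A) (hC : MeasurableSet C)
    (hbC : Bornology.IsBounded C) :
    meanWeight P X r p g (C \ A) 0 ≤
      ENNReal.ofReal (Real.exp (Λ (C ∩ A)).toReal) * meanWeight P X r p g C 0 := by
  have hbA : Bornology.IsBounded (C ∩ A) := hbC.subset Set.inter_subset_left
  -- Indicator of the void event. On it, the restrictions of `X` to `C` and to `C \ A` agree.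
  let φ : ℕ → ℝ≥0∞ := fun n => if n = 0 then 1 else 0
  have hφ : Measurable φ := .of_discrete
  have h1 := lintegral_mul_weight_eq (r := r) (p := p) hX hL hgm (hC.inter hA) (hC.diff hA) hbA
    (hbC.subset Set.sdiff_subset) Set.disjoint_sdiff_inter.symm
    (f := fun ν => φ (count ν Set.univ))
    (hφ.comp (measurable_count measurable_truncate MeasurableSet.univ))
  simp only [count_restrict_univ] at h1
  have h2 : ∫⁻ ω, φ (count (X ω) (C ∩ A)) ∂P =
      ENNReal.ofReal (Real.exp (-(Λ (C ∩ A)).toReal)) := by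
    rw [← hX.measure_count_eq_zero (hC.inter hA) hbA, ← lintegral_indicator_one]
    · refine lintegral_congr fun ω => ?_
      simp [φ, Set.indicator]
    · exact measurable_count hX.isPointProcess.measurable (hC.inter hA) (measurableSet_singleton 0)
  have h3 : ∫⁻ ω, φ (count (X ω) (C ∩ A)) * weight r p g ((X ω).restrict (C \ A)) 0 ∂P ≤
      meanWeight P X r p g C 0 := by
    refine lintegral_mono fun ω => ?_
    by_cases h : count (X ω) (C ∩ A) = 0
    · have h4 := hX.isPointProcess.coe_count (hC.inter hA) hbA ω
      rw [h, Nat.cast_zero] at h4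
      simp [φ, h, restrict_eq_restrict_sdiff hA h4.symm]
    · simp [φ, h]
  rw [h1, h2] at h3
  calc meanWeight P X r p g (C \ A) 0
      = ENNReal.ofReal (Real.exp (Λ (C ∩ A)).toReal) *
        (ENNReal.ofReal (Real.exp (-(Λ (C ∩ A)).toReal)) * meanWeight P X r p g (C \ A) 0) := by
        rw [← mul_assoc, ← ENNReal.ofReal_mul (Real.exp_pos _).le, ← Real.exp_add]
        simp
    _ ≤ _ := by gcongr

/-- One step of the exploration: the points within distance `r` of the extra neighbour `x` are
revealed, and take over the role of `x`. -/
lemma meanWeight_diracSum_cons_le [IsFiniteMeasureOnCompacts Λ] (hX : IsPoissonProcess P X Λ)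
    (hL : IsLocallyDiracSum X) (hp : ∀ n, p n ∈ Set.Icc (0 : ℝ) 1) (hgm : Measurable g)
    (hg : ∀ y, 0 ≤ g y) (hgM : ∀ y, g y ≤ M) {μ : ℝ}
    (hμ : ∀ x, (Λ (Metric.closedBall x r)).toReal ≤ μ) {C : Set (Space d)} (hC : MeasurableSet C)
    (hbC : Bornology.IsBounded C) (x : Space d) (l : List (Space d)) {K : ℝ≥0∞}
    (hK : ∀ l, meanWeight P X r p g (C \ Metric.closedBall x r) (diracSum l) ≤
      K * 2 ^ l.length * meanWeight P X r p g (C \ Metric.closedBall x r) 0) :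
    meanWeight P X r p g C (diracSum (x :: l)) ≤
      ENNReal.ofReal (Real.exp (2 * μ)) * (K * 2 ^ l.length * meanWeight P X r p g C 0) := by
  set B := Metric.closedBall x r
  have hB : MeasurableSet B := measurableSet_closedBall
  have hCB : MeasurableSet (C ∩ B) := hC.inter hB
  have hbCB : Bornology.IsBounded (C ∩ B) := hbC.subset Set.inter_subset_left
  have hΛ : (Λ (C ∩ B)).toReal ≤ μ :=
    (ENNReal.toReal_mono (Metric.isBounded_closedBall.measure_lt_top).ne
      (measure_mono Set.inter_subset_right)).trans (hμ x)
  have h1 : meanWeight P X r p g C (diracSum (x :: l)) ≤ ∫⁻ ω, 1 *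
      weight r p g ((X ω).restrict (C \ B)) ((X ω).restrict (C ∩ B) + diracSum l) ∂P := by
    refine lintegral_mono fun ω => ?_
    have := hL.isFiniteMeasure_restrict hC hbC ω
    -- The points of `C ∩ B` are dropped from the weight and survive only as neighbours. The points
    -- still weighted lie outside `B`, at distance more than `r` from `x`, so `x` itself can be
    -- forgotten.
    have h2 := weight_le_weight_restrict (r := r) hp hgm hg hgM hB ((X ω).restrict C)
      (diracSum (x :: l))
    rw [Measure.restrict_restrict hB.compl, Measure.restrict_restrict hB, Set.inter_comm Bᶜ,
      ← Set.sdiff_eq, Set.inter_comm B, diracSum_cons, add_left_comm,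
      weight_add_right_of_far (ν := (X ω).restrict (C \ B)) (C := B)] at h2
    · simpa using h2
    · rw [Measure.restrict_apply hB, Set.inter_sdiff_self, measure_empty]
    · intro y hy _
      rw [Measure.dirac_apply' _ measurableSet_closedBall, Set.indicator_of_notMem]
      simpa [B, dist_comm] using hy
  have h3 := lintegral_mul_weight_le (r := r) (p := p) hX hL hgm hCB (hC.diff hB) hbCB
    (hbC.subset Set.sdiff_subset) Set.disjoint_sdiff_inter.symm (f := fun _ => 1)
    measurable_const hK l
  simp only [one_mul] at h1 h3
  rw [lintegral_two_pow_count hX hCB hbCB] at h3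
  refine (h1.trans h3).trans ?_
  -- One factor `exp μ` bounds the mean of `2 ^ N`, with `N` the number of revealed points; the
  -- other pays for returning from `C \ B` to `C`.
  calc ENNReal.ofReal (Real.exp (Λ (C ∩ B)).toReal) *
        (K * 2 ^ l.length * meanWeight P X r p g (C \ B) 0)
      ≤ ENNReal.ofReal (Real.exp μ) * (K * 2 ^ l.length *
        (ENNReal.ofReal (Real.exp μ) * meanWeight P X r p g C 0)) := by
        gcongr
        refine (meanWeight_sdiff_le hX hL hgm hB hC hbC).trans ?_
        gcongr
    _ = (ENNReal.ofReal (Real.exp μ) * ENNReal.ofReal (Real.exp μ)) *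
        (K * 2 ^ l.length * meanWeight P X r p g C 0) := by ring
    _ = _ := by
        rw [← ENNReal.ofReal_mul (Real.exp_pos _).le, ← Real.exp_add, two_mul]

/-- At low density, each extra neighbour increases the mean weight by a factor of at most two. -/
lemma meanWeight_diracSum_le [IsFiniteMeasureOnCompacts Λ] (hX : IsPoissonProcess P X Λ)
    (hL : IsLocallyDiracSum X) (hp : ∀ n, p n ∈ Set.Icc (0 : ℝ) 1) (hgm : Measurable g)
    (hg : ∀ y, 0 ≤ g y) (hgM : ∀ y, g y ≤ M)
    (hμ : ∀ x, (Λ (Metric.closedBall x r)).toReal ≤ 1 / 4) {C : Set (Space d)}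
    (hC : MeasurableSet C) (hbC : Bornology.IsBounded C) (l : List (Space d)) :
    meanWeight P X r p g C (diracSum l) ≤ 2 ^ l.length * meanWeight P X r p g C 0 := by
  set a : ℝ≥0∞ := ENNReal.ofReal (Real.exp (Λ C).toReal) with ha
  -- An exploration step costs `exp (2μ)` with `μ = 1/4`, which is below `1.65`, hence below `2θ`.
  -- The strict gain `θ < 1` drives the iteration.
  set θ : ℝ≥0∞ := ENNReal.ofReal (9 / 10) with hθ
  have hθ1 : θ < 1 := by
    rw [hθ, ENNReal.ofReal_lt_one]
    norm_num
  have hexp : ENNReal.ofReal (Real.exp (2 * (1 / 4))) ≤ θ * 2 := by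
    rw [hθ, ← ENNReal.ofReal_ofNat, ← ENNReal.ofReal_mul (by norm_num)]
    refine ENNReal.ofReal_le_ofReal ?_
    have h1 : Real.exp (2 * (1 / 4)) ^ 2 = Real.exp 1 := by
      rw [← Real.exp_nat_mul]; norm_num
    have h2 := Real.exp_one_lt_d9
    nlinarith [Real.exp_pos (2 * (1 / 4))]
  -- Exploration does not shorten the list, as revealed points replace `x`, so the induction is on
  -- the number `n` of steps and not on `l`. A crude initial constant `a` is damped by `θ` at each
  -- step and disappears in the limit. The set varies because each step removes a ball.
  have key : ∀ n : ℕ, ∀ C' ⊆ C, MeasurableSet C' → ∀ l : List (Space d),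
      meanWeight P X r p g C' (diracSum l) ≤
        (1 + θ ^ n * a) * 2 ^ l.length * meanWeight P X r p g C' 0 := by
    intro n
    induction n with
    | zero =>
      intro C' hC' hmC' l
      have hb' := hbC.subset hC'
      have h1 := meanWeight_sdiff_le (r := r) (p := p) (A := C') hX hL hgm hmC' hmC' hb'
      -- The empty configuration has weight one and probability at least `1 / a`.
      have h2 : (1 : ℝ≥0∞) ≤ a * meanWeight P X r p g C' 0 := by
        have h3 : meanWeight P X r p g (C' \ C') 0 = 1 := by simp [meanWeight]
        rw [h3, Set.inter_self] at h1
        refine h1.trans ?_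
        gcongr
        exact ENNReal.ofReal_le_ofReal (Real.exp_le_exp.2 (ENNReal.toReal_mono
          (hbC.measure_lt_top (μ := Λ)).ne (measure_mono hC')))
      calc meanWeight P X r p g C' (diracSum l) ≤ 1 := meanWeight_le_one hp hg _ _
        _ ≤ 1 * (a * meanWeight P X r p g C' 0) := by rwa [one_mul]
        _ ≤ 2 ^ l.length * ((1 + θ ^ 0 * a) * meanWeight P X r p g C' 0) := by
            gcongr
            · exact one_le_pow₀ (by norm_num)
            · simp
        _ = _ := by ring
    | succ n ih =>
      intro C' hC' hmC' l
      cases l with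
      | nil =>
        simp only [diracSum_nil, List.length_nil, pow_zero, mul_one]
        exact le_mul_of_one_le_left' (by simp)
      | cons x l =>
        refine (meanWeight_diracSum_cons_le hX hL hp hgm hg hgM hμ hmC' (hbC.subset hC') x l
          (ih _ (Set.sdiff_subset.trans hC') (hmC'.diff measurableSet_closedBall))).trans ?_
        calc ENNReal.ofReal (Real.exp (2 * (1 / 4))) *
              ((1 + θ ^ n * a) * 2 ^ l.length * meanWeight P X r p g C' 0)
            ≤ θ * 2 * ((1 + θ ^ n * a) * 2 ^ l.length * meanWeight P X r p g C' 0) := by gcongr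
          _ = (θ + θ ^ (n + 1) * a) * 2 ^ (l.length + 1) * meanWeight P X r p g C' 0 := by ring
          _ ≤ _ := by
              rw [List.length_cons]
              gcongr
  have hlim : Filter.Tendsto
      (fun n : ℕ => (1 + θ ^ n * a) * (2 ^ l.length * meanWeight P X r p g C 0)) Filter.atTop
      (nhds ((1 + 0 * a) * (2 ^ l.length * meanWeight P X r p g C 0))) := by
    have hfin : 2 ^ l.length * meanWeight P X r p g C 0 ≠ ∞ :=
      ENNReal.mul_ne_top (by simp) (ne_top_of_le_ne_top ENNReal.one_ne_top
        (meanWeight_le_one hp hg _ _))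
    refine ENNReal.Tendsto.mul_const (tendsto_const_nhds.add ?_) (Or.inr hfin)
    exact ENNReal.Tendsto.mul_const (ENNReal.tendsto_pow_atTop_nhds_zero_of_lt_one hθ1)
      (Or.inr ENNReal.ofReal_ne_top)
  have := ge_of_tendsto' hlim fun n => by
    simpa only [mul_assoc] using key n C subset_rfl hC l
  simpa using this

end MeanWeight

/-! ### The effect of switching on `g` on a small set -/

section Pointwise

variable {d : ℕ} {r : ℝ} {p : ℕ → ℝ} {g : Space d → ℝ} {M : ℝ} {V A : Set (Space d)}

lemma rate_indicator_union (hVA : Disjoint V A) (y : Space d) (m : ℕ) :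
    rate p ((V ∪ A).indicator g) y m =
      rate p (V.indicator g) y m + rate p (A.indicator g) y m := by
  by_cases hV : y ∈ V
  · have hA : y ∉ A := Set.disjoint_left.1 hVA hV
    simp [rate, hV, hA]
  · by_cases hA : y ∈ A <;> simp [rate, hV, hA]

lemma indicator_nonneg_of_nonneg (hg : ∀ y, 0 ≤ g y) (S : Set (Space d)) (y : Space d) :
    0 ≤ S.indicator g y := Set.indicator_nonneg (fun y _ => hg y) y

lemma indicator_le_of_le (hg : ∀ y, 0 ≤ g y) (hgM : ∀ y, g y ≤ M) (S : Set (Space d))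
    (y : Space d) : S.indicator g y ≤ M :=
  (Set.indicator_le_self' (fun y _ => hg y) y).trans (hgM y)

/-- The relative loss of weight when `g` is switched on. -/
noncomputable def loss (r : ℝ) (p : ℕ → ℝ) (g : Space d → ℝ) (ν : Measure (Space d)) : ℝ :=
  1 - Real.exp (-energy r p g ν 0)

lemma loss_nonneg (hp : ∀ n, p n ∈ Set.Icc (0 : ℝ) 1) (hg : ∀ y, 0 ≤ g y)
    (ν : Measure (Space d)) : 0 ≤ loss r p g ν := by
  have := Real.exp_le_one_iff.2 (neg_nonpos.2 (energy_nonneg (r := r) hp hg ν 0))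
  unfold loss
  linarith

/-- Rates add up over disjoint supports of `g`, because the neighbour counts do not depend on `g`.
So switching on `A` multiplies the weight by one minus the loss. -/
lemma weight_eq_weight_union_add (hp : ∀ n, p n ∈ Set.Icc (0 : ℝ) 1) (hgm : Measurable g)
    (hg : ∀ y, 0 ≤ g y) (hgM : ∀ y, g y ≤ M) (hV : MeasurableSet V) (hA : MeasurableSet A)
    (hVA : Disjoint V A) (ν : Measure (Space d)) [IsFiniteMeasure ν] :
    weight r p (V.indicator g) ν 0 = weight r p ((V ∪ A).indicator g) ν 0 +
      weight r p (V.indicator g) ν 0 * ENNReal.ofReal (loss r p (A.indicator g) ν) := by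
  have h1 : energy r p ((V ∪ A).indicator g) ν 0 =
      energy r p (V.indicator g) ν 0 + energy r p (A.indicator g) ν 0 := by
    unfold energy
    simp_rw [rate_indicator_union hVA]
    exact integral_add
      (integrable_rate hp (hgm.indicator hV) (indicator_nonneg_of_nonneg hg V)
        (indicator_le_of_le hg hgM V) ν _)
      (integrable_rate hp (hgm.indicator hA) (indicator_nonneg_of_nonneg hg A)
        (indicator_le_of_le hg hgM A) ν _)
  have h2 := loss_nonneg (r := r) hp (indicator_nonneg_of_nonneg hg A) ν
  rw [weight, weight, h1, ← ENNReal.ofReal_mul (Real.exp_pos _).le,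
    ← ENNReal.ofReal_add (Real.exp_pos _).le (mul_nonneg (Real.exp_pos _).le h2), loss, neg_add,
    Real.exp_add]
  congr 1
  ring

/-- Bernoulli's inequality. The prefactor `1 - exp(-M)` is at most one, which makes the smallness
condition independent of `g`, and at most `M`, which gives the final bound linear in `g`. -/
lemma one_sub_exp_neg_mul_le (n : ℕ) (M : ℝ) :
    1 - Real.exp (-(M * n)) ≤ (1 - Real.exp (-M)) * n := by
  have h := one_add_mul_le_pow (a := Real.exp (-M) - 1) (by linarith [Real.exp_pos (-M)]) n
  rw [add_sub_cancel, ← Real.exp_nat_mul] at h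
  rw [show -(M * n) = n * -M by ring]
  linarith

lemma loss_le (hp : ∀ n, p n ∈ Set.Icc (0 : ℝ) 1) (hgm : Measurable g)
    (hg : ∀ y, 0 ≤ g y) (hgM : ∀ y, g y ≤ M) (hA : MeasurableSet A)
    (ν : Measure (Space d)) [IsFiniteMeasure ν] {n : ℕ} (hn : ν A = n) :
    loss r p (A.indicator g) ν ≤ (1 - Real.exp (-M)) * n := by
  refine le_trans ?_ (one_sub_exp_neg_mul_le n M)
  refine sub_le_sub_left (Real.exp_le_exp.2 (neg_le_neg ?_)) _
  calc energy r p (A.indicator g) ν 0 ≤ ∫ y, A.indicator (fun _ => M) y ∂ν := by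
        refine integral_mono (integrable_rate hp (hgm.indicator hA)
          (indicator_nonneg_of_nonneg hg A) (indicator_le_of_le hg hgM A) ν _)
          ((integrable_const M).indicator hA) fun y => ?_
        refine (rate_le hp (indicator_nonneg_of_nonneg hg A) _ _).trans ?_
        exact Set.indicator_le_indicator (hgM y)
    _ = M * n := by
        rw [integral_indicator_const _ hA, smul_eq_mul, mul_comm, measureReal_def, hn,
          ENNReal.toReal_natCast]

/-- An isolated point of `A` does not affect the weight of the other points when `g` vanishes on
`A`. -/
lemma weight_add_dirac {x₀ y : Space d} (hp : ∀ n, p n ∈ Set.Icc (0 : ℝ) 1)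
    (hgm : Measurable g) (hg : ∀ y, 0 ≤ g y) (hgM : ∀ y, g y ≤ M)
    (hy : y ∈ Metric.closedBall x₀ r) (hgy : g y = 0) (ν : Measure (Space d)) [IsFiniteMeasure ν]
    (hν : ν (Metric.closedBall x₀ (2 * r)) = 0) :
    weight r p g (ν + Measure.dirac y) 0 = weight r p g ν 0 := by
  have h1 : weight r p g ν (Measure.dirac y + 0) = weight r p g ν 0 := by
    refine weight_add_right_of_far hν fun z hz _ => ?_
    rw [Measure.dirac_apply' _ measurableSet_closedBall, Set.indicator_of_notMem]
    intro h
    refine hz ?_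
    rw [Metric.mem_closedBall] at h hy ⊢
    linarith [dist_triangle z y x₀, dist_comm y z]
  rw [← h1, add_zero, weight, weight, energy, energy, add_zero, integral_add_measure,
    integral_dirac, rate_eq_zero hgy, add_zero]
  · exact integrable_rate hp hgm hg hgM _ _
  · exact integrable_rate hp hgm hg hgM _ _

/-- This is where `p 0` enters: `y` has no neighbours, and all other points lie where `g` vanishes.
-/
lemma loss_add_dirac {x₀ y : Space d} (hr : 0 ≤ r) (hp : ∀ n, p n ∈ Set.Icc (0 : ℝ) 1)
    (hgm : Measurable g) (hg : ∀ y, 0 ≤ g y) (hgM : ∀ y, g y ≤ M)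
    (hgA : ∀ z ∉ Metric.closedBall x₀ r, g z = 0)
    (hy : y ∈ Metric.closedBall x₀ r) (ν : Measure (Space d)) [IsFiniteMeasure ν]
    (hν : ν (Metric.closedBall x₀ (2 * r)) = 0) :
    loss r p g (ν + Measure.dirac y) = p 0 * (1 - Real.exp (-g y)) := by
  have h0 : neighbourCount r y (ν + Measure.dirac y) = 0 := by
    have h1 : ν (Metric.closedBall y r \ {y}) = 0 := by
      refine measure_mono_null (fun z hz => ?_) hν
      have hz := hz.1
      rw [Metric.mem_closedBall] at hz hy ⊢
      linarith [dist_triangle z y x₀]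
    have h2 : Measure.dirac y (Metric.closedBall y r \ {y}) = 0 := by
      rw [Measure.dirac_apply' _ (measurableSet_closedBall.diff (measurableSet_singleton y))]
      simp
    simp [neighbourCount, h1, h2]
  have h3 : ∫ z, rate p g z (neighbourCount r z (ν + Measure.dirac y)) ∂ν = 0 := by
    refine integral_eq_zero_of_ae ?_
    filter_upwards [measure_eq_zero_iff_ae_notMem.1 hν] with z hz
    refine rate_eq_zero (hgA z fun h => hz ?_) _
    exact Metric.closedBall_subset_closedBall (by linarith) h
  have h4 : energy r p g (ν + Measure.dirac y) 0 = rate p g y 0 := by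
    rw [energy, add_zero, integral_add_measure, h3, integral_dirac, h0, zero_add]
    · exact integrable_rate hp hgm hg hgM _ _
    · exact integrable_rate hp hgm hg hgM _ _
  rw [loss, h4, exp_neg_rate hp hg]
  ring

end Pointwise

/-! ### Moments of counts -/

section Counts

variable {d : ℕ} {Ω : Type*} [MeasurableSpace Ω] {P : Measure Ω}
  {X : Ω → Measure (Space d)} {Λ : Measure (Space d)} {A B : Set (Space d)}

/-- Campbell's formula. -/
lemma IsPoissonProcess.lintegral_lintegral (hX : IsPoissonProcess P X Λ)
    [IsFiniteMeasureOnCompacts Λ] (hB : MeasurableSet B) (hb : Bornology.IsBounded B)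
    {f : Space d → ℝ≥0∞} (hf : Measurable f) :
    ∫⁻ ω, ∫⁻ y, f y ∂((X ω).restrict B) ∂P = ∫⁻ y, f y ∂(Λ.restrict B) := by
  have hm := measurable_restrict_of_measurable hX.isPointProcess.measurable hB
  -- It suffices that the mean measure of the restricted process is the restriction of `Λ`, which is
  -- the mean of a Poisson variable on each set.
  rw [← Measure.lintegral_bind hm.aemeasurable hf.aemeasurable]
  congr 1
  ext s hs
  have hsb : Bornology.IsBounded (s ∩ B) := hb.subset Set.inter_subset_right
  rw [Measure.bind_apply hs hm.aemeasurable]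
  simp_rw [Measure.restrict_apply hs]
  have h1 : ∀ ω, X ω (s ∩ B) = (count (X ω) (s ∩ B) : ℝ≥0∞) := fun ω =>
    (hX.isPointProcess.coe_count (hs.inter hB) hsb ω).symm
  simp_rw [h1]
  rw [hX.lintegral_count (hs.inter hB) hsb (fun n => (n : ℝ≥0∞))]
  have h2 := lintegral_mul_poissonMeasure (Λ (s ∩ B)).toNNReal (fun _ => 1)
  simp only [mul_one, lintegral_const, measure_univ] at h2
  rw [h2, ENNReal.coe_toNNReal hsb.measure_lt_top.ne]

lemma count_add_count_sdiff (hX : IsPointProcess X) (hA : MeasurableSet A) (hB : MeasurableSet B)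
    (hb : Bornology.IsBounded B) (hAB : A ⊆ B) (ω : Ω) :
    count (X ω) B = count (X ω) A + count (X ω) (B \ A) := by
  have h1 := hX.coe_count hB hb ω
  have h2 := hX.coe_count hA (hb.subset hAB) ω
  have h3 := hX.coe_count (hB.diff hA) (hb.subset Set.sdiff_subset) ω
  have h4 : X ω B = X ω A + X ω (B \ A) := by
    rw [← measure_inter_add_sdiff B hA, Set.inter_eq_right.2 hAB]
  rw [← h1, ← h2, ← h3] at h4
  exact_mod_cast h4

/-- With at least two points in `B`, the number of points in `A` is at most the number of ordered
pairs with first point in `A` and second in `B`. Splitting by whether the second point is in `A`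
gives independent Poisson moments: with `a = Λ A` and `b = Λ B`, the total is `4a² + 4a(b - a) =
4ab`, times the exponential. -/
lemma lintegral_count_mul_two_pow_le [IsProbabilityMeasure P] (hX : IsPoissonProcess P X Λ)
    [IsFiniteMeasureOnCompacts Λ] (hA : MeasurableSet A) (hB : MeasurableSet B)
    (hb : Bornology.IsBounded B) (hAB : A ⊆ B) :
    ∫⁻ ω, (if 2 ≤ count (X ω) B then (count (X ω) A : ℝ≥0∞) else 0) * 2 ^ count (X ω) B ∂P ≤
      4 * Λ A * Λ B * ENNReal.ofReal (Real.exp (Λ B).toReal) := by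
  have hbA := hb.subset hAB
  have hbD : Bornology.IsBounded (B \ A) := hb.subset Set.sdiff_subset
  have hD := hB.diff hA
  have hm := hX.isPointProcess.measurable
  let φ₀ : ℕ → ℝ≥0∞ := fun n => 2 ^ n
  let φ₁ : ℕ → ℝ≥0∞ := fun n => n * 2 ^ n
  let φ₂ : ℕ → ℝ≥0∞ := fun n => n * (((n - 1 : ℕ) : ℝ≥0∞) * 2 ^ n)
  have hpt : ∀ m n : ℕ, (if 2 ≤ m + n then (m : ℝ≥0∞) else 0) * 2 ^ (m + n) ≤
      φ₂ m * φ₀ n + φ₁ m * φ₁ n := by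
    intro m n
    have h : (if 2 ≤ m + n then (m : ℝ≥0∞) else 0) ≤ m * ((m - 1 : ℕ) : ℝ≥0∞) + m * n := by
      split_ifs with h
      · norm_cast
        rw [← mul_add]
        rcases Nat.eq_zero_or_pos m with rfl | hm
        · simp
        · exact Nat.le_mul_of_pos_right _ (by omega)
      · exact zero_le
    calc _ ≤ (m * ((m - 1 : ℕ) : ℝ≥0∞) + m * n) * 2 ^ (m + n) := by gcongr
      _ = _ := by simp only [φ₀, φ₁, φ₂, pow_add]; ring
  have hind : IndepFun (fun ω => count (X ω) A) (fun ω => count (X ω) (B \ A)) P := by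
    have h := (hX.indepFun_restrict hA hD hbA hbD Set.disjoint_sdiff_right).comp
      (measurable_count measurable_id MeasurableSet.univ)
      (measurable_count measurable_id MeasurableSet.univ)
    simpa only [Function.comp_def, id, count_restrict_univ] using h
  have hmul : ∀ φ ψ : ℕ → ℝ≥0∞, ∫⁻ ω, φ (count (X ω) A) * ψ (count (X ω) (B \ A)) ∂P =
      (∫⁻ n, φ n ∂(poissonMeasure (Λ A).toNNReal)) *
        ∫⁻ n, ψ n ∂(poissonMeasure (Λ (B \ A)).toNNReal) := by
    intro φ ψ
    have hφ : Measurable φ := .of_discrete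
    have hψ : Measurable ψ := .of_discrete
    rw [← hX.lintegral_count hA hbA, ← hX.lintegral_count hD hbD]
    exact lintegral_mul_eq_lintegral_mul_lintegral_of_indepFun''
      (hφ.comp (measurable_count hm hA)).aemeasurable
      (hψ.comp (measurable_count hm hD)).aemeasurable (hind.comp hφ hψ)
  have hφm : ∀ φ ψ : ℕ → ℝ≥0∞,
      Measurable fun ω => φ (count (X ω) A) * ψ (count (X ω) (B \ A)) := fun φ ψ =>
    (Measurable.of_discrete.comp (measurable_count hm hA)).mul
      (Measurable.of_discrete.comp (measurable_count hm hD))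
  calc _ ≤ ∫⁻ ω, φ₂ (count (X ω) A) * φ₀ (count (X ω) (B \ A)) +
        φ₁ (count (X ω) A) * φ₁ (count (X ω) (B \ A)) ∂P := by
        refine lintegral_mono fun ω => ?_
        rw [count_add_count_sdiff hX.isPointProcess hA hB hb hAB ω]
        exact hpt _ _
    _ = 4 * Λ A * Λ B * ENNReal.ofReal (Real.exp (Λ B).toReal) := by
        have hΛA := (hbA.measure_lt_top (μ := Λ)).ne
        have hΛD := (hbD.measure_lt_top (μ := Λ)).ne
        have hΛB : Λ B = Λ A + Λ (B \ A) := by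
          rw [← measure_inter_add_sdiff B hA, Set.inter_eq_right.2 hAB]
        rw [lintegral_add_left (hφm _ _), hmul, hmul, lintegral_two_pow_poissonMeasure,
          lintegral_mul_two_pow_poissonMeasure, lintegral_mul_two_pow_poissonMeasure,
          lintegral_mul_pred_mul_two_pow_poissonMeasure, hΛB, ENNReal.toReal_add hΛA hΛD,
          Real.exp_add, ENNReal.ofReal_mul (Real.exp_pos _).le, ENNReal.coe_toNNReal hΛA,
          ENNReal.coe_toNNReal hΛD, ENNReal.coe_toNNReal_eq_toReal,
          ENNReal.coe_toNNReal_eq_toReal]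
        ring

end Counts

/-! ### The numerical estimate behind one cell -/

section RealEstimate

lemma abs_log_one_sub_add_le {u : ℝ} (hu₀ : 0 ≤ u) (hu : u ≤ 1 / 2) :
    |Real.log (1 - u) + u| ≤ 2 * (u * u) := by
  have h1u : 0 < 1 - u := by linarith
  have hl1 : Real.log (1 - u) ≤ -u := by linarith [Real.log_le_sub_one_of_pos h1u]
  have hl2 : -u - 2 * (u * u) ≤ Real.log (1 - u) := by
    refine le_trans ?_ (Real.one_sub_inv_le_log_of_pos h1u)
    have h : (1 - u)⁻¹ ≤ 1 + u + 2 * (u * u) := by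
      rw [inv_le_iff_one_le_mul₀ h1u]
      nlinarith
    linarith
  have := mul_nonneg hu₀ hu₀
  rw [abs_le]
  constructor <;> linarith

/-- `F` and `F'` are the mean weights before and after switching on the cell `A`, `D` is the mean
loss, `Z` the mean weight away from the ball `B`, `s` the integral of `1 - exp(-g)` over `A`, `T`
its single-point part, `R` the moment from several points in `B`; `a = Λ A`, `b = Λ B`, `q = p 0`
and `G = 1 - exp(-M)`. With `u = D / F`, the logarithm is `log (1 - u)`. The constant is `16 = 7 + 1
+ 8`, in units of `G * a * b`: from `u` against `q * s`, from `q * s` against `m * s`, and from the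
quadratic error `2u²`. -/
lemma abs_log_sub_log_add_le {F F' D Z T R s a b G m q : ℝ} (hF : 0 < F) (hF' : F = F' + D)
    (hZF : Z ≤ Real.exp b * F) (hFZ : F ≤ Real.exp b * Z)
    (hD₁ : q * T * Z ≤ D) (hD₂ : D ≤ (q * T + G * R) * Z) (hT₀ : 0 ≤ T)
    (hT : T ≤ s) (hs : s ≤ T + G * R) (hsG : s ≤ G * a) (hR₀ : 0 ≤ R)
    (hR : R ≤ 4 * a * b * Real.exp b)
    (hG₀ : 0 ≤ G) (hG₁ : G ≤ 1) (ha : 0 ≤ a) (hab : a ≤ b) (hb : b ≤ 1 / 100)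
    (hq₀ : 0 ≤ q) (hq₁ : q ≤ 1) (hm : |m - q| ≤ b) :
    0 < F' ∧ |Real.log F' - Real.log F + m * s| ≤ 16 * (G * a * b) := by
  have hb₀ : 0 ≤ b := ha.trans hab
  have he1 : Real.exp b ≤ 1 + 2 * b := by
    have := Real.abs_exp_sub_one_le (x := b) (by rw [abs_of_nonneg hb₀]; linarith)
    rw [abs_of_nonneg hb₀] at this
    linarith [le_abs_self (Real.exp b - 1)]
  have he2 : 1 + b ≤ Real.exp b := by linarith [Real.add_one_le_exp b]
  set E := Real.exp b
  have hE : E ≤ 102 / 100 := by linarith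
  set k := Z / F with hk
  set u := D / F with hu
  have hZ : Z = k * F := by rw [hk]; field_simp
  have hDu : D = u * F := by rw [hu]; field_simp
  rw [hZ] at hZF hFZ hD₁ hD₂
  rw [hDu] at hD₁ hD₂
  have hk1 : k ≤ E := le_of_mul_le_mul_right hZF hF
  have hk2 : 1 ≤ E * k := by
    refine le_of_mul_le_mul_right ?_ hF
    linarith
  have hu1 : q * T * k ≤ u := by
    refine le_of_mul_le_mul_right ?_ hF
    linarith
  have hu2 : u ≤ (q * T + G * R) * k := by
    refine le_of_mul_le_mul_right ?_ hF
    linarith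
  have hEpos : 0 < E := by linarith
  have hk0 : 0 ≤ k := ((mul_pos_iff_of_pos_left hEpos).1 (by linarith)).le
  have hk3 : 1 - 2 * b ≤ k := by
    refine le_of_mul_le_mul_left (le_trans ?_ hk2) hEpos
    calc E * (1 - 2 * b) ≤ (1 + 2 * b) * (1 - 2 * b) := by gcongr; linarith
      _ = 1 - 4 * (b * b) := by ring
      _ ≤ 1 := by linarith [mul_nonneg hb₀ hb₀]
  have hs0 : 0 ≤ s := hT₀.trans hT
  have hGa : 0 ≤ G * a := mul_nonneg hG₀ ha
  have hGab : 0 ≤ G * a * b := mul_nonneg hGa hb₀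
  have hGR0 : 0 ≤ G * R := mul_nonneg hG₀ hR₀
  have hGR : G * R ≤ 408 / 100 * (G * a * b) := by
    calc G * R ≤ G * (4 * a * b * E) := by gcongr
      _ = 4 * (G * a * b) * E := by ring
      _ ≤ 4 * (G * a * b) * (102 / 100) := by gcongr
      _ = _ := by ring
  have hqs0 : 0 ≤ q * s := mul_nonneg hq₀ hs0
  have hqs : q * s ≤ G * a := (mul_le_of_le_one_left hs0 hq₁).trans hsG
  have hqT1 : q * T ≤ q * s := by gcongr
  have hqT2 : q * s - G * R ≤ q * T := by
    have h1 : q * s ≤ q * (T + G * R) := by gcongr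
    have h2 : q * (G * R) ≤ G * R := mul_le_of_le_one_left hGR0 hq₁
    linarith
  have hqsb : q * s * b ≤ G * a * b := by gcongr
  have hkGR : k * (G * R) ≤ 102 / 100 * (G * R) := by gcongr; linarith
  -- Two units come from `Z / F` differing from one, and less than five from `k * (G * R)`.
  have hlow : q * s - 7 * (G * a * b) ≤ u := by
    have h1 : (q * s - G * R) * k ≤ u := le_trans (by gcongr) hu1
    have h2 : q * s * (1 - 2 * b) ≤ q * s * k := by gcongr
    linarith
  have hup : u ≤ q * s + 7 * (G * a * b) := by
    have h1 : u ≤ (q * s + G * R) * k := hu2.trans (by gcongr)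
    have h2 : q * s * k ≤ q * s * (1 + 2 * b) := by gcongr; linarith
    linarith
  have hms : |m * s - q * s| ≤ G * a * b := by
    rw [← sub_mul, abs_mul, abs_of_nonneg hs0]
    calc |m - q| * s ≤ b * (G * a) := by gcongr
      _ = _ := by ring
  obtain ⟨hms1, hms2⟩ := abs_le.1 hms
  have hGabs : G * a * b ≤ G * a * (1 / 100) := by gcongr
  have hu0 : 0 ≤ u := le_trans (mul_nonneg (mul_nonneg hq₀ hT₀) hk0) hu1
  have hu3 : u ≤ 2 * (G * a) := by linarith
  have hGa2 : G * a ≤ b := (mul_le_of_le_one_left ha hG₁).trans hab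
  have hGa1 : G * a ≤ 1 / 100 := hGa2.trans hb
  have hu4 : u ≤ 1 / 2 := by linarith
  -- The square is of the same order as the other errors because `G * a ≤ b`.
  have husq : u * u ≤ 4 * (G * a * b) := by
    calc u * u ≤ (2 * (G * a)) * (2 * (G * a)) := by gcongr
      _ = 4 * (G * a * (G * a)) := by ring
      _ ≤ 4 * (G * a * b) := by gcongr
  have hF'u : F' = F * (1 - u) := by rw [hDu] at hF'; linarith
  have h1u : 0 < 1 - u := by linarith
  refine ⟨by rw [hF'u]; positivity, ?_⟩
  have hlog : Real.log F' - Real.log F = Real.log (1 - u) := by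
    rw [hF'u, Real.log_mul hF.ne' h1u.ne']
    ring
  obtain ⟨hl1, hl2⟩ := abs_le.1 (abs_log_one_sub_add_le hu0 hu4)
  rw [hlog, abs_le]
  constructor <;> linarith

end RealEstimate

/-! ### The loss caused by one cell, for a fixed configuration -/

section Cell

variable {d : ℕ} {Ω : Type*} {X : Ω → Measure (Space d)} {Λ : Measure (Space d)}
  {r : ℝ} {p : ℕ → ℝ} {g : Space d → ℝ} {M : ℝ} {V A C : Set (Space d)} {x₀ : Space d}

/-- The sum of `f` over the points of a configuration that has a single point, and zero
otherwise. -/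
noncomputable def singlePointSum (f : Space d → ℝ≥0∞) (ν : Measure (Space d)) : ℝ≥0∞ :=
  (if count ν Set.univ = 1 then 1 else 0) * ∫⁻ y, f y ∂ν

lemma measurable_singlePointSum {f : Space d → ℝ≥0∞} (hf : Measurable f) :
    Measurable (singlePointSum f) := by
  have h1 : Measurable fun n : ℕ => if n = 1 then (1 : ℝ≥0∞) else 0 := .of_discrete
  exact (h1.comp (measurable_count measurable_id MeasurableSet.univ)).mul
    (Measure.measurable_lintegral hf)

/-- The function `1 - exp(-g)`. -/
noncomputable def hit (g : Space d → ℝ) (y : Space d) : ℝ≥0∞ :=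
  ENNReal.ofReal (1 - Real.exp (-g y))

lemma measurable_hit (hgm : Measurable g) : Measurable (hit g) := by
  unfold hit
  fun_prop

lemma hit_indicator_le (hgM : ∀ y, g y ≤ M) (A : Set (Space d)) (y : Space d) :
    hit (A.indicator g) y ≤ A.indicator (fun _ => ENNReal.ofReal (1 - Real.exp (-M))) y := by
  by_cases hy : y ∈ A
  · simp only [hit, hy, Set.indicator_of_mem]
    refine ENNReal.ofReal_le_ofReal (sub_le_sub_left (Real.exp_le_exp.2 ?_) _)
    exact neg_le_neg (hgM y)
  · simp [hit, hy]

lemma lintegral_hit_indicator_le (hgM : ∀ y, g y ≤ M) (hA : MeasurableSet A)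
    (ν : Measure (Space d)) :
    ∫⁻ y, hit (A.indicator g) y ∂ν ≤ ENNReal.ofReal (1 - Real.exp (-M)) * ν A :=
  (lintegral_mono fun y => hit_indicator_le hgM A y).trans (by
    rw [lintegral_indicator_const hA])

/-- The weight lost to a single point of `A` with no other points near it. -/
lemma weight_mul_loss_of_count_eq_one (hr : 0 ≤ r)
    (hL : IsLocallyDiracSum X) (hp : ∀ n, p n ∈ Set.Icc (0 : ℝ) 1) (hgm : Measurable g)
    (hg : ∀ y, 0 ≤ g y) (hgM : ∀ y, g y ≤ M) (hV : MeasurableSet V) (hA : MeasurableSet A)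
    (hVA : Disjoint V A) (hA₀ : A ⊆ Metric.closedBall x₀ r) (hC : MeasurableSet C)
    (hbC : Bornology.IsBounded C) (hBC : Metric.closedBall x₀ (2 * r) ⊆ C) {ω : Ω}
    (h1 : count (X ω) (Metric.closedBall x₀ (2 * r)) = 1) :
    weight r p (V.indicator g) ((X ω).restrict C) 0 *
        ENNReal.ofReal (loss r p (A.indicator g) ((X ω).restrict C)) =
      ENNReal.ofReal (p 0) *
        (singlePointSum (hit (A.indicator g)) ((X ω).restrict (Metric.closedBall x₀ (2 * r))) *
          weight r p (V.indicator g) ((X ω).restrict (C \ Metric.closedBall x₀ (2 * r))) 0) := by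
  set B := Metric.closedBall x₀ (2 * r)
  have hB : MeasurableSet B := measurableSet_closedBall
  have hbB : Bornology.IsBounded B := Metric.isBounded_closedBall
  have hAB : A ⊆ B := hA₀.trans (Metric.closedBall_subset_closedBall (by linarith))
  have hfC := hL.isFiniteMeasure_restrict hC hbC ω
  have hfD := hL.isFiniteMeasure_restrict (hC.diff hB) (hbC.subset Set.sdiff_subset) ω
  obtain ⟨l, hl⟩ := hL ω B hB hbB
  have hlen := length_eq_count hl
  rw [h1, List.length_eq_one_iff] at hlen
  obtain ⟨y, rfl⟩ := hlen
  rw [diracSum_cons, diracSum_nil, add_zero] at hl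
  have hsplit : (X ω).restrict C = (X ω).restrict (C \ B) + Measure.dirac y := by
    rw [← hl, ← Measure.restrict_inter_add_sdiff C hB, Set.inter_eq_right.2 hBC, add_comm]
  have hνB : (X ω).restrict (C \ B) B = 0 := by
    rw [Measure.restrict_apply hB, Set.inter_sdiff_self, measure_empty]
  have hsp : singlePointSum (hit (A.indicator g)) ((X ω).restrict B) = hit (A.indicator g) y := by
    rw [singlePointSum, count_restrict_univ, h1, hl, lintegral_dirac]
    simp
  rw [hsp]
  by_cases hy : y ∈ A
  · have hyV : V.indicator g y = 0 :=
      Set.indicator_of_notMem (Set.disjoint_right.1 hVA hy) _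
    rw [hsplit, weight_add_dirac hp (hgm.indicator hV) (indicator_nonneg_of_nonneg hg V)
      (indicator_le_of_le hg hgM V) (hA₀ hy) hyV _ hνB,
      loss_add_dirac hr hp (hgm.indicator hA) (indicator_nonneg_of_nonneg hg A)
      (indicator_le_of_le hg hgM A)
      (fun z hz => Set.indicator_of_notMem (fun h => hz (hA₀ h)) _) (hA₀ hy) _ hνB,
      ENNReal.ofReal_mul (hp 0).1, hit]
    ring
  -- The only point of `B` misses `A`, so both sides vanish.
  · have h0 : (X ω).restrict C A = ((0 : ℕ) : ℝ≥0∞) := by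
      have h2 : Measure.dirac y A = 0 := by
        rw [Measure.dirac_apply' _ hA, Set.indicator_of_notMem hy]
      rw [hsplit, Measure.add_apply, h2, measure_mono_null hAB hνB]
      simp
    have h3 := loss_le (r := r) hp hgm hg hgM hA _ h0
    rw [Nat.cast_zero, mul_zero] at h3
    have h4 : hit (A.indicator g) y = 0 := by simp [hit, hy]
    rw [ENNReal.ofReal_of_nonpos h3, h4]
    simp

variable [MeasurableSpace Ω] {P : Measure Ω}

/-- Upper bound for the weight lost to the points of `A`. -/
lemma weight_mul_loss_le (hr : 0 ≤ r) (hX : IsPoissonProcess P X Λ)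
    (hL : IsLocallyDiracSum X) (hp : ∀ n, p n ∈ Set.Icc (0 : ℝ) 1) (hgm : Measurable g)
    (hg : ∀ y, 0 ≤ g y) (hgM : ∀ y, g y ≤ M) (hV : MeasurableSet V) (hA : MeasurableSet A)
    (hVA : Disjoint V A) (hA₀ : A ⊆ Metric.closedBall x₀ r) (hC : MeasurableSet C)
    (hbC : Bornology.IsBounded C) (hBC : Metric.closedBall x₀ (2 * r) ⊆ C) (ω : Ω) :
    weight r p (V.indicator g) ((X ω).restrict C) 0 *
        ENNReal.ofReal (loss r p (A.indicator g) ((X ω).restrict C)) ≤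
      ENNReal.ofReal (p 0) *
        (singlePointSum (hit (A.indicator g)) ((X ω).restrict (Metric.closedBall x₀ (2 * r))) *
          weight r p (V.indicator g) ((X ω).restrict (C \ Metric.closedBall x₀ (2 * r))) 0) +
      ENNReal.ofReal (1 - Real.exp (-M)) *
        ((if 2 ≤ count (X ω) (Metric.closedBall x₀ (2 * r)) then (count (X ω) A : ℝ≥0∞) else 0) *
          weight r p (V.indicator g) ((X ω).restrict (C \ Metric.closedBall x₀ (2 * r)))
            ((X ω).restrict (Metric.closedBall x₀ (2 * r)))) := by
  set B := Metric.closedBall x₀ (2 * r) with hBdef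
  have hB : MeasurableSet B := measurableSet_closedBall
  have hbB : Bornology.IsBounded B := Metric.isBounded_closedBall
  have hAB : A ⊆ B := hA₀.trans (Metric.closedBall_subset_closedBall (by linarith))
  have hfC := hL.isFiniteMeasure_restrict hC hbC ω
  have hcA : (X ω).restrict C A = (count (X ω) A : ℝ≥0∞) := by
    rw [Measure.restrict_apply hA, Set.inter_eq_left.2 (hAB.trans hBC),
      hX.isPointProcess.coe_count hA (hbB.subset hAB)]
  have hloss := loss_le (r := r) hp hgm hg hgM hA _ hcA
  by_cases h1 : count (X ω) B = 1
  · rw [weight_mul_loss_of_count_eq_one hr hL hp hgm hg hgM hV hA hVA hA₀ hC hbC hBC h1]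
    exact le_self_add
  · by_cases h2 : 2 ≤ count (X ω) B
    · refine le_add_left ?_
      rw [if_pos h2]
      -- With several points in `B` no exact formula is attempted: they are dropped from the weight
      -- and kept as neighbours of the points outside.
      have hw := weight_le_weight_restrict (r := r) hp (hgm.indicator hV)
        (indicator_nonneg_of_nonneg hg V) (indicator_le_of_le hg hgM V) hB ((X ω).restrict C) 0
      rw [Measure.restrict_restrict hB.compl, Measure.restrict_restrict hB, Set.inter_comm Bᶜ,
        ← Set.sdiff_eq, Set.inter_eq_left.2 hBC, add_zero] at hw
      have hl : ENNReal.ofReal (loss r p (A.indicator g) ((X ω).restrict C)) ≤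
          ENNReal.ofReal (1 - Real.exp (-M)) * count (X ω) A := by
        rw [← ENNReal.ofReal_natCast, ← ENNReal.ofReal_mul' (Nat.cast_nonneg _)]
        exact ENNReal.ofReal_le_ofReal hloss
      calc _ ≤ weight r p (V.indicator g) ((X ω).restrict (C \ B)) ((X ω).restrict B) *
            (ENNReal.ofReal (1 - Real.exp (-M)) * count (X ω) A) := by gcongr
        _ = _ := by ring
    · have h0 : count (X ω) A = 0 := by
        have := count_add_count_sdiff hX.isPointProcess hA hB hbB hAB ω
        omega
      rw [h0, Nat.cast_zero, mul_zero] at hloss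
      rw [ENNReal.ofReal_of_nonpos hloss, mul_zero]
      exact zero_le

end Cell

/-! ### The mean effect of one cell -/

section CellMean

variable {d : ℕ} {Ω : Type*} [MeasurableSpace Ω] {P : Measure Ω}
  {X : Ω → Measure (Space d)} {Λ : Measure (Space d)}
  {r : ℝ} {p : ℕ → ℝ} {g : Space d → ℝ} {M : ℝ} {V A C B : Set (Space d)} {x₀ : Space d}

lemma measurable_weight_restrict (hX : IsPoissonProcess P X Λ) (hL : IsLocallyDiracSum X)
    (hgm : Measurable g) (hC : MeasurableSet C) (hbC : Bornology.IsBounded C) :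
    Measurable fun ω => weight r p g ((X ω).restrict C) 0 :=
  measurable_weight hgm (measurable_restrict_of_measurable hX.isPointProcess.measurable hC)
    measurable_const (hL.isFiniteMeasure_restrict hC hbC) (fun _ => inferInstance)

/-- The mean weight decreases by the mean loss. -/
lemma meanWeight_eq_meanWeight_union_add (hX : IsPoissonProcess P X Λ)
    (hL : IsLocallyDiracSum X) (hp : ∀ n, p n ∈ Set.Icc (0 : ℝ) 1) (hgm : Measurable g)
    (hg : ∀ y, 0 ≤ g y) (hgM : ∀ y, g y ≤ M) (hV : MeasurableSet V) (hA : MeasurableSet A)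
    (hVA : Disjoint V A) (hC : MeasurableSet C) (hbC : Bornology.IsBounded C) :
    meanWeight P X r p (V.indicator g) C 0 = meanWeight P X r p ((V ∪ A).indicator g) C 0 +
      ∫⁻ ω, weight r p (V.indicator g) ((X ω).restrict C) 0 *
        ENNReal.ofReal (loss r p (A.indicator g) ((X ω).restrict C)) ∂P := by
  rw [meanWeight, meanWeight, ← lintegral_add_left (measurable_weight_restrict hX hL
    (hgm.indicator (hV.union hA)) hC hbC)]
  refine lintegral_congr fun ω => ?_
  have := hL.isFiniteMeasure_restrict hC hbC ω
  exact weight_eq_weight_union_add hp hgm hg hgM hV hA hVA _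

variable [IsFiniteMeasureOnCompacts Λ]

/-- Campbell's formula writes the left side as a mean of sums over points, which is split according
to whether `B` holds one point or several. The factor `2 ^ count` is not needed here; it makes the
error the same moment as in the upper bound for the loss. -/
lemma lintegral_hit_le (hX : IsPoissonProcess P X Λ) (hgm : Measurable g)
    (hgM : ∀ y, g y ≤ M) (hA : MeasurableSet A) (hB : MeasurableSet B)
    (hbB : Bornology.IsBounded B) (hAB : A ⊆ B) :
    ∫⁻ y, hit (A.indicator g) y ∂Λ ≤
      ∫⁻ ω, singlePointSum (hit (A.indicator g)) ((X ω).restrict B) ∂P +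
      ENNReal.ofReal (1 - Real.exp (-M)) *
        ∫⁻ ω, (if 2 ≤ count (X ω) B then (count (X ω) A : ℝ≥0∞) else 0) * 2 ^ count (X ω) B ∂P := by
  have hh := measurable_hit (hgm.indicator hA)
  have hΛ : ∫⁻ y, hit (A.indicator g) y ∂Λ = ∫⁻ y, hit (A.indicator g) y ∂(Λ.restrict B) := by
    refine (setLIntegral_eq_of_support_subset fun y hy => ?_).symm
    by_contra hyB
    exact hy (by simp [hit, show y ∉ A from fun h => hyB (hAB h)])
  rw [hΛ, ← hX.lintegral_lintegral hB hbB hh, ← lintegral_const_mul', ← lintegral_add_left]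
  · refine lintegral_mono fun ω => ?_
    have hle := lintegral_hit_indicator_le hgM hA ((X ω).restrict B)
    rw [Measure.restrict_apply hA, Set.inter_eq_left.2 hAB,
      ← hX.isPointProcess.coe_count hA (hbB.subset hAB)] at hle
    by_cases h1 : count (X ω) B = 1
    · refine le_add_right ?_
      simp [singlePointSum, count_restrict_univ, h1]
    · refine le_add_left (hle.trans ?_)
      by_cases h2 : 2 ≤ count (X ω) B
      · rw [if_pos h2]
        gcongr
        exact le_mul_of_one_le_right' (one_le_pow₀ (by norm_num))
      · have h0 : count (X ω) A = 0 := by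
          have := count_add_count_sdiff hX.isPointProcess hA hB hbB hAB ω
          omega
        simp [h0]
  · exact (measurable_singlePointSum hh).comp
      (measurable_restrict_of_measurable hX.isPointProcess.measurable hB)
  · exact ENNReal.ofReal_ne_top

lemma lintegral_singlePointSum_le (hX : IsPoissonProcess P X Λ) (hB : MeasurableSet B)
    (hbB : Bornology.IsBounded B) {f : Space d → ℝ≥0∞} (hf : Measurable f) :
    ∫⁻ ω, singlePointSum f ((X ω).restrict B) ∂P ≤ ∫⁻ y, f y ∂Λ := by
  calc ∫⁻ ω, singlePointSum f ((X ω).restrict B) ∂P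
      ≤ ∫⁻ ω, ∫⁻ y, f y ∂((X ω).restrict B) ∂P := by
        refine lintegral_mono fun ω => ?_
        unfold singlePointSum
        split_ifs <;> simp
    _ = ∫⁻ y, f y ∂(Λ.restrict B) := hX.lintegral_lintegral hB hbB hf
    _ ≤ _ := lintegral_mono' Measure.restrict_le_self le_rfl

variable [IsProbabilityMeasure P]

/-- The counterpart of `meanWeight_sdiff_le`. The points of `B` remain as extra neighbours, and
`meanWeight_diracSum_le` charges two for each; `exp (Λ B)` is the mean of `2 ^ N` for the number `N`
of points in `B`. -/
lemma meanWeight_le_mul_sdiff (hX : IsPoissonProcess P X Λ)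
    (hL : IsLocallyDiracSum X) (hp : ∀ n, p n ∈ Set.Icc (0 : ℝ) 1) (hgm : Measurable g)
    (hg : ∀ y, 0 ≤ g y) (hgM : ∀ y, g y ≤ M)
    (hμ : ∀ x, (Λ (Metric.closedBall x r)).toReal ≤ 1 / 4)
    (hB : MeasurableSet B) (hC : MeasurableSet C) (hbC : Bornology.IsBounded C) (hBC : B ⊆ C) :
    meanWeight P X r p g C 0 ≤
      ENNReal.ofReal (Real.exp (Λ B).toReal) * meanWeight P X r p g (C \ B) 0 := by
  have hbB := hbC.subset hBC
  have hbD : Bornology.IsBounded (C \ B) := hbC.subset Set.sdiff_subset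
  have h := lintegral_mul_weight_le (r := r) (p := p) hX hL hgm hB (hC.diff hB) hbB hbD
    Set.disjoint_sdiff_right (f := fun _ => 1) measurable_const (K := 1)
    (fun l => by simpa using meanWeight_diracSum_le hX hL hp hgm hg hgM hμ (hC.diff hB) hbD l) []
  simp only [one_mul, diracSum_nil, List.length_nil, pow_zero, add_zero] at h
  rw [lintegral_two_pow_count hX hB hbB] at h
  refine le_trans (lintegral_mono fun ω => ?_) h
  have := hL.isFiniteMeasure_restrict hC hbC ω
  have hw := weight_le_weight_restrict (r := r) hp hgm hg hgM hB ((X ω).restrict C) 0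
  rwa [Measure.restrict_restrict hB.compl, Measure.restrict_restrict hB, Set.inter_comm Bᶜ,
    ← Set.sdiff_eq, Set.inter_eq_left.2 hBC, add_zero] at hw

/-- Switching on `g` on a set `A` of diameter comparable to `r` multiplies the mean weight by
`exp(-m ∫_A (1 - exp(-g)) dΛ)`, up to a small error. -/
theorem abs_log_meanWeight_union_le (hr : 0 ≤ r) (hX : IsPoissonProcess P X Λ)
    (hL : IsLocallyDiracSum X) (hp : ∀ n, p n ∈ Set.Icc (0 : ℝ) 1) (hgm : Measurable g)
    (hg : ∀ y, 0 ≤ g y) (hgM : ∀ y, g y ≤ M) (hV : MeasurableSet V) (hA : MeasurableSet A)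
    (hVA : Disjoint V A) (hA₀ : A ⊆ Metric.closedBall x₀ r) (hC : MeasurableSet C)
    (hbC : Bornology.IsBounded C) (hBC : Metric.closedBall x₀ (2 * r) ⊆ C)
    (hμ : ∀ x, (Λ (Metric.closedBall x r)).toReal ≤ 1 / 4)
    (hb : (Λ (Metric.closedBall x₀ (2 * r))).toReal ≤ 1 / 100) {m : ℝ}
    (hm : |m - p 0| ≤ (Λ (Metric.closedBall x₀ (2 * r))).toReal)
    (hpos : 0 < (meanWeight P X r p (V.indicator g) C 0).toReal) :
    0 < (meanWeight P X r p ((V ∪ A).indicator g) C 0).toReal ∧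
    |Real.log (meanWeight P X r p ((V ∪ A).indicator g) C 0).toReal -
      Real.log (meanWeight P X r p (V.indicator g) C 0).toReal +
      m * (∫⁻ y, hit (A.indicator g) y ∂Λ).toReal| ≤
    16 * ((1 - Real.exp (-M)) * (Λ A).toReal * (Λ (Metric.closedBall x₀ (2 * r))).toReal) := by
  set B := Metric.closedBall x₀ (2 * r) with hBdef
  have hB : MeasurableSet B := measurableSet_closedBall
  have hbB : Bornology.IsBounded B := Metric.isBounded_closedBall
  have hAB : A ⊆ B := hA₀.trans (Metric.closedBall_subset_closedBall (by linarith))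
  have hbD : Bornology.IsBounded (C \ B) := hbC.subset Set.sdiff_subset
  have hD := hC.diff hB
  have hΛA := ((hbB.subset hAB).measure_lt_top (μ := Λ)).ne
  have hΛB := (hbB.measure_lt_top (μ := Λ)).ne
  have hgV := hgm.indicator hV
  have hg0V := indicator_nonneg_of_nonneg hg V
  have hgMV := indicator_le_of_le hg hgM V
  have hM : 0 ≤ M := (hg x₀).trans (hgM x₀)
  have hG0 : 0 ≤ 1 - Real.exp (-M) := by
    linarith [Real.exp_le_one_iff.2 (neg_nonpos.2 hM)]
  have hG1 : 1 - Real.exp (-M) ≤ 1 := by linarith [Real.exp_pos (-M)]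
  set G : ℝ≥0∞ := ENNReal.ofReal (1 - Real.exp (-M)) with hGdef
  have hGr : G.toReal = 1 - Real.exp (-M) := ENNReal.toReal_ofReal hG0
  have hfin : ∀ (g' : Space d → ℝ) (hg' : ∀ y, 0 ≤ g' y) (C' : Set (Space d)),
      meanWeight P X r p g' C' 0 ≠ ∞ := fun g' hg' C' =>
    ne_top_of_le_ne_top ENNReal.one_ne_top (meanWeight_le_one hp hg' _ _)
  set F := meanWeight P X r p (V.indicator g) C 0 with hF
  set F' := meanWeight P X r p ((V ∪ A).indicator g) C 0 with hF'
  set Z := meanWeight P X r p (V.indicator g) (C \ B) 0 with hZ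
  have hF'fin : F' ≠ ∞ := hfin _ (indicator_nonneg_of_nonneg hg _) _
  have hFfin : F ≠ ∞ := hfin _ hg0V _
  have hZfin : Z ≠ ∞ := hfin _ hg0V _
  set D := ∫⁻ ω, weight r p (V.indicator g) ((X ω).restrict C) 0 *
        ENNReal.ofReal (loss r p (A.indicator g) ((X ω).restrict C)) ∂P with hDdef
  have hFD : F = F' + D :=
    meanWeight_eq_meanWeight_union_add hX hL hp hgm hg hgM hV hA hVA hC hbC
  have hDfin : D ≠ ∞ := ne_top_of_le_ne_top hFfin (hFD ▸ le_add_self)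
  set T := ∫⁻ ω, singlePointSum (hit (A.indicator g)) ((X ω).restrict B) ∂P with hT
  set R := ∫⁻ ω, (if 2 ≤ count (X ω) B then (count (X ω) A : ℝ≥0∞) else 0) *
    2 ^ count (X ω) B ∂P with hR
  set s := ∫⁻ y, hit (A.indicator g) y ∂Λ with hs
  have hh := measurable_hit (hgm.indicator hA)
  have hsp : Measurable fun ν : Measure (Space d) =>
      singlePointSum (hit (A.indicator g)) (truncate ν) :=
    (measurable_singlePointSum hh).comp measurable_truncate
  have hTZ := lintegral_mul_weight_eq (r := r) (p := p) hX hL hgV hB hD hbB hbD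
    Set.disjoint_sdiff_right hsp
  have hmT : Measurable fun ω => singlePointSum (hit (A.indicator g)) ((X ω).restrict B) *
      weight r p (V.indicator g) ((X ω).restrict (C \ B)) 0 :=
    ((measurable_singlePointSum hh).comp
      (measurable_restrict_of_measurable hX.isPointProcess.measurable hB)).mul
      (measurable_weight_restrict hX hL hgV hD hbD)
  -- Only configurations with exactly one point in `B` are kept; the loss is nonnegative on the
  -- others, where `singlePointSum` is zero.
  have hDlow : ENNReal.ofReal (p 0) * T * Z ≤ D := by
    rw [mul_assoc, ← hTZ, ← lintegral_const_mul _ hmT]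
    refine lintegral_mono fun ω => ?_
    by_cases h1 : count (X ω) B = 1
    · rw [weight_mul_loss_of_count_eq_one hr hL hp hgm hg hgM hV hA hVA hA₀ hC hbC hBC h1]
    · simp [singlePointSum, count_restrict_univ, h1]
  let φ : ℕ × ℕ → ℝ≥0∞ := fun q => if 2 ≤ q.1 then (q.2 : ℝ≥0∞) else 0
  have hφ : Measurable φ := .of_discrete
  have hcA : ∀ ω, count ((X ω).restrict B) A = count (X ω) A := fun ω => by
    rw [count, count, Measure.restrict_apply hA, Set.inter_eq_left.2 hAB]
  -- Compares the mean weight in the presence of the points of `B` with `Z`. This makes the error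
  -- from several points relative to the mean weight.
  have hRZ := lintegral_mul_weight_le (r := r) (p := p) hX hL hgV hB hD hbB hbD
    Set.disjoint_sdiff_right (f := fun ν => φ (count ν Set.univ, count ν A))
    (hφ.comp ((measurable_count measurable_truncate MeasurableSet.univ).prodMk
      (measurable_count measurable_truncate hA))) (K := 1)
    (fun l => by simpa using meanWeight_diracSum_le hX hL hp hgV hg0V hgMV hμ hD hbD l) []
  simp only [φ, count_restrict_univ, hcA, diracSum_nil, add_zero, List.length_nil, pow_zero,
    one_mul] at hRZ
  have hDup : D ≤ (ENNReal.ofReal (p 0) * T + G * R) * Z := by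
    calc D ≤ ∫⁻ ω, (ENNReal.ofReal (p 0) *
          (singlePointSum (hit (A.indicator g)) ((X ω).restrict B) *
            weight r p (V.indicator g) ((X ω).restrict (C \ B)) 0) +
          G * ((if 2 ≤ count (X ω) B then (count (X ω) A : ℝ≥0∞) else 0) *
            weight r p (V.indicator g) ((X ω).restrict (C \ B)) ((X ω).restrict B))) ∂P :=
          lintegral_mono fun ω =>
            weight_mul_loss_le hr hX hL hp hgm hg hgM hV hA hVA hA₀ hC hbC hBC ω
      _ ≤ ENNReal.ofReal (p 0) * (T * Z) + G * (R * Z) := by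
          rw [lintegral_add_left (hmT.const_mul _), lintegral_const_mul _ hmT, hTZ,
            lintegral_const_mul' _ _ ENNReal.ofReal_ne_top]
          gcongr
      _ = _ := by ring
  have hRle : R ≤ 4 * Λ A * Λ B * ENNReal.ofReal (Real.exp (Λ B).toReal) :=
    lintegral_count_mul_two_pow_le hX hA hB hbB hAB
  have hRfin' : 4 * Λ A * Λ B * ENNReal.ofReal (Real.exp (Λ B).toReal) ≠ ∞ :=
    ENNReal.mul_ne_top (ENNReal.mul_ne_top (ENNReal.mul_ne_top (by simp) hΛA) hΛB)
      ENNReal.ofReal_ne_top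
  have hRfin : R ≠ ∞ := ne_top_of_le_ne_top hRfin' hRle
  have hsG : s ≤ G * Λ A := lintegral_hit_indicator_le hgM hA Λ
  have hGΛ : G * Λ A ≠ ∞ := ENNReal.mul_ne_top ENNReal.ofReal_ne_top hΛA
  have hsfin : s ≠ ∞ := ne_top_of_le_ne_top hGΛ hsG
  have hTs : T ≤ s := lintegral_singlePointSum_le hX hB hbB hh
  have hTfin : T ≠ ∞ := ne_top_of_le_ne_top hsfin hTs
  have hGR : G * R ≠ ∞ := ENNReal.mul_ne_top ENNReal.ofReal_ne_top hRfin
  have hsT : s ≤ T + G * R := lintegral_hit_le hX hgm hgM hA hB hbB hAB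
  have hpT : ENNReal.ofReal (p 0) * T ≠ ∞ := ENNReal.mul_ne_top ENNReal.ofReal_ne_top hTfin
  have hFZ : F ≤ ENNReal.ofReal (Real.exp (Λ B).toReal) * Z :=
    meanWeight_le_mul_sdiff hX hL hp hgV hg0V hgMV hμ hB hC hbC hBC
  have hZF : Z ≤ ENNReal.ofReal (Real.exp (Λ B).toReal) * F := by
    have := meanWeight_sdiff_le (r := r) (p := p) hX hL hgV hB hC hbC
    rwa [Set.inter_eq_right.2 hBC] at this
  have hexp := (Real.exp_pos (Λ B).toReal).le
  refine abs_log_sub_log_add_le (D := D.toReal) (Z := Z.toReal) (T := T.toReal) (R := R.toReal)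
    (q := p 0) hpos ?_ ?_ ?_ ?_ ?_ ENNReal.toReal_nonneg ?_ ?_ ?_ ENNReal.toReal_nonneg ?_ hG0 hG1
    ENNReal.toReal_nonneg (ENNReal.toReal_mono hΛB (measure_mono hAB)) hb (hp 0).1 (hp 0).2 hm
  · rw [hFD, ENNReal.toReal_add hF'fin hDfin]
  · have := ENNReal.toReal_mono (ENNReal.mul_ne_top ENNReal.ofReal_ne_top hFfin) hZF
    rwa [ENNReal.toReal_mul, ENNReal.toReal_ofReal hexp] at this
  · have := ENNReal.toReal_mono (ENNReal.mul_ne_top ENNReal.ofReal_ne_top hZfin) hFZ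
    rwa [ENNReal.toReal_mul, ENNReal.toReal_ofReal hexp] at this
  · have := ENNReal.toReal_mono hDfin hDlow
    rwa [ENNReal.toReal_mul, ENNReal.toReal_mul, ENNReal.toReal_ofReal (hp 0).1] at this
  · have := ENNReal.toReal_mono (ENNReal.mul_ne_top (ENNReal.add_ne_top.2 ⟨hpT, hGR⟩) hZfin) hDup
    rwa [ENNReal.toReal_mul, ENNReal.toReal_add hpT hGR, ENNReal.toReal_mul, ENNReal.toReal_mul,
      ENNReal.toReal_ofReal (hp 0).1, hGr] at this
  · exact ENNReal.toReal_mono hsfin hTs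
  · have := ENNReal.toReal_mono (ENNReal.add_ne_top.2 ⟨hTfin, hGR⟩) hsT
    rwa [ENNReal.toReal_add hTfin hGR, ENNReal.toReal_mul, hGr] at this
  · have := ENNReal.toReal_mono hGΛ hsG
    rwa [ENNReal.toReal_mul, hGr] at this
  · have := ENNReal.toReal_mono hRfin' hRle
    rwa [ENNReal.toReal_mul, ENNReal.toReal_mul, ENNReal.toReal_mul, ENNReal.toReal_ofReal hexp,
      ENNReal.toReal_ofNat] at this

end CellMean

/-! ### The mean weight of a low-density Poisson process -/

section Cover

variable {d : ℕ} {Ω : Type*} [MeasurableSpace Ω] {P : Measure Ω} [IsProbabilityMeasure P]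
  {X : Ω → Measure (Space d)} {Λ : Measure (Space d)} [IsFiniteMeasureOnCompacts Λ]
  {r : ℝ} {p : ℕ → ℝ} {g : Space d → ℝ} {M : ℝ}

lemma hit_indicator_union {V A : Set (Space d)} (hVA : Disjoint V A) (y : Space d) :
    hit ((V ∪ A).indicator g) y = hit (V.indicator g) y + hit (A.indicator g) y := by
  by_cases hV : y ∈ V
  · have hA : y ∉ A := Set.disjoint_left.1 hVA hV
    simp [hit, hV, hA]
  · by_cases hA : y ∈ A <;> simp [hit, hV, hA]

/-- Telescoping over a finite cover of `W` by balls of radius `r`, starting from `g = 0` with mean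
weight one. The new cells are made disjoint, so their errors sum to a multiple of `Λ W`. The margin
`2 * r` in the large ball makes room for the doubled ball around every centre. -/
theorem abs_log_meanWeight_add_le (hr : 0 < r) (hX : IsPoissonProcess P X Λ)
    (hL : IsLocallyDiracSum X) (hp : ∀ n, p n ∈ Set.Icc (0 : ℝ) 1) (hgm : Measurable g)
    (hg : ∀ y, 0 ≤ g y) (hgM : ∀ y, g y ≤ M) {W : Set (Space d)} (hW : MeasurableSet W)
    {ρ : ℝ} (hWρ : W ⊆ Metric.closedBall 0 ρ) (hgW : Function.support g ⊆ W)
    (hμ : ∀ x, (Λ (Metric.closedBall x r)).toReal ≤ 1 / 4) {β : ℝ}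
    (hβ : ∀ x, (Λ (Metric.closedBall x (2 * r))).toReal = β) (hβ' : β ≤ 1 / 100) {m : ℝ}
    (hm : |m - p 0| ≤ β) :
    0 < (meanWeight P X r p g (Metric.closedBall 0 (ρ + 2 * r)) 0).toReal ∧
    |Real.log (meanWeight P X r p g (Metric.closedBall 0 (ρ + 2 * r)) 0).toReal +
      m * (∫⁻ y, hit g y ∂Λ).toReal| ≤ 16 * ((1 - Real.exp (-M)) * (Λ W).toReal * β) := by
  classical
  set C : Set (Space d) := Metric.closedBall 0 (ρ + 2 * r) with hCdef
  have hC : MeasurableSet C := measurableSet_closedBall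
  have hbC : Bornology.IsBounded C := Metric.isBounded_closedBall
  have hbW : Bornology.IsBounded W := Metric.isBounded_closedBall.subset hWρ
  obtain ⟨t, hts, htf, htc⟩ :=
    (isCompact_closedBall (0 : Space d) ρ).finite_cover_balls hr
  have key : ∀ u : Finset (Space d), (u : Set (Space d)) ⊆ Metric.closedBall 0 ρ →
      0 < (meanWeight P X r p ((W ∩ ⋃ c ∈ u, Metric.closedBall c r).indicator g) C 0).toReal ∧
      |Real.log
        (meanWeight P X r p ((W ∩ ⋃ c ∈ u, Metric.closedBall c r).indicator g) C 0).toReal +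
        m * (∫⁻ y, hit ((W ∩ ⋃ c ∈ u, Metric.closedBall c r).indicator g) y ∂Λ).toReal| ≤
      16 * ((1 - Real.exp (-M)) * (Λ (W ∩ ⋃ c ∈ u, Metric.closedBall c r)).toReal * β) := by
    intro u
    induction u using Finset.induction_on with
    | empty =>
      intro _
      have h0 : (W ∩ ⋃ c ∈ (∅ : Finset (Space d)), Metric.closedBall c r).indicator g =
          fun _ => 0 := by simp
      rw [h0]
      simp [meanWeight, weight, energy, rate, hit]
    | insert c u hc ih =>
      intro hu
      rw [Finset.coe_insert, Set.insert_subset_iff] at hu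
      obtain ⟨ih1, ih2⟩ := ih hu.2
      set V := W ∩ ⋃ c ∈ u, Metric.closedBall c r with hVdef
      set A := (W ∩ Metric.closedBall c r) \ V with hAdef
      have hVm : MeasurableSet V :=
        hW.inter (u.measurableSet_biUnion fun c _ => measurableSet_closedBall)
      have hAm : MeasurableSet A := (hW.inter measurableSet_closedBall).diff hVm
      have hVA : Disjoint V A := Set.disjoint_sdiff_right
      have hunion : W ∩ ⋃ c' ∈ insert c u, Metric.closedBall c' r = V ∪ A := by
        rw [Finset.set_biUnion_insert, Set.inter_union_distrib_left, hAdef, Set.union_sdiff_self,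
          Set.union_comm]
      have hBC : Metric.closedBall c (2 * r) ⊆ C := by
        refine Metric.closedBall_subset_closedBall' ?_
        have := Metric.mem_closedBall.1 hu.1
        linarith
      have hA₀ : A ⊆ Metric.closedBall c r := Set.sdiff_subset.trans Set.inter_subset_right
      obtain ⟨h1, h2⟩ := abs_log_meanWeight_union_le hr.le hX hL hp hgm hg hgM hVm hAm hVA hA₀ hC
        hbC hBC hμ ((hβ c).trans_le hβ') (m := m) (by rwa [hβ c]) ih1
      have hΛV := ((hbW.subset Set.inter_subset_left : Bornology.IsBounded V).measure_lt_top
        (μ := Λ)).ne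
      have hΛA := ((Metric.isBounded_closedBall.subset hA₀).measure_lt_top (μ := Λ)).ne
      have hfin : ∀ S : Set (Space d), MeasurableSet S → Λ S ≠ ∞ →
          ∫⁻ y, hit (S.indicator g) y ∂Λ ≠ ∞ := fun S hS hΛ =>
        ne_top_of_le_ne_top (ENNReal.mul_ne_top ENNReal.ofReal_ne_top hΛ)
          (lintegral_hit_indicator_le hgM hS Λ)
      rw [hunion]
      refine ⟨h1, ?_⟩
      have h3 : (∫⁻ y, hit ((V ∪ A).indicator g) y ∂Λ).toReal =
          (∫⁻ y, hit (V.indicator g) y ∂Λ).toReal + (∫⁻ y, hit (A.indicator g) y ∂Λ).toReal := by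
        simp_rw [hit_indicator_union hVA]
        rw [lintegral_add_left (measurable_hit (hgm.indicator hVm)),
          ENNReal.toReal_add (hfin V hVm hΛV) (hfin A hAm hΛA)]
      have h4 : (Λ (V ∪ A)).toReal = (Λ V).toReal + (Λ A).toReal := by
        rw [measure_union hVA hAm, ENNReal.toReal_add hΛV hΛA]
      rw [hβ c] at h2
      rw [h3, h4]
      rw [abs_le] at h2 ih2 ⊢
      constructor <;> linarith [h2.1, h2.2, ih2.1, ih2.2]
  have hfinal := key htf.toFinset (by simpa using hts)
  have hWu : W ∩ ⋃ c ∈ htf.toFinset, Metric.closedBall c r = W := by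
    refine Set.inter_eq_left.2 fun x hx => ?_
    obtain ⟨c, hc, hxc⟩ := Set.mem_iUnion₂.1 (htc (hWρ hx))
    exact Set.mem_iUnion₂.2 ⟨c, by simpa using hc, Metric.ball_subset_closedBall hxc⟩
  rw [hWu, Set.indicator_eq_self.2 hgW] at hfinal
  exact hfinal

end Cover

/-! ### Integrating out the marks -/

section SumDirac

variable {E : Type*} [MeasurableSpace E] [MeasurableSingletonClass E]

/-- Only finitely many atoms lie in `W`, so the partial sums are eventually constant. This reduces
everything about marks to finite products. -/
lemma exists_integral_sum_dirac_eq {c : ℕ → Prop} [DecidablePred c] {x : ℕ → E} {W : Set E} (hW : MeasurableSet W)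
    (hfin : Measure.sum (fun i => if c i then Measure.dirac (x i) else 0) W ≠ ∞) {f : E → ℝ}
    (hf : Function.support f ⊆ W) :
    ∃ n₀, ∀ n ≥ n₀,
      ∫ y, f y ∂(Measure.sum (fun i => if c i then Measure.dirac (x i) else 0)) =
        ∑ i ∈ Finset.range n, if c i then f (x i) else 0 := by
  classical
  obtain ⟨n₀, hn₀⟩ := exists_restrict_sum_dirac_eq hW hfin
  refine ⟨n₀, fun n hn => ?_⟩
  rw [← setIntegral_eq_integral_of_forall_compl_eq_zero (s := W)
    (fun y hy => Function.notMem_support.1 fun h => hy (hf h)), hn₀ n hn,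
    integral_finsetSum_measure]
  · refine Finset.sum_congr rfl fun i _ => ?_
    by_cases hc : c i
    · by_cases hx : x i ∈ W
      · simp [hc, hx]
      · have : f (x i) = 0 := Function.notMem_support.1 fun h => hx (hf h)
        simp [hx, this]
    · simp [hc]
  · intro i _
    split_ifs
    · exact integrable_dirac (by simp)
    · exact integrable_zero_measure

end SumDirac

section Marks

variable {d : ℕ} {Ω : Type*} [MeasurableSpace Ω] {P : Measure Ω}
  {X : Ω → Measure (Space d)} {κ : Ω → ℕ∞} {ξ : ℕ → Ω → Space d} {U : ℕ → Ω → ℝ}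
  {r : ℝ} {p : ℕ → ℝ} {g : Space d → ℝ}

lemma IsUniformMarking.isLocallyDiracSum (hM : IsUniformMarking P X κ ξ U)
    (hX : IsPointProcess X) : IsLocallyDiracSum X := by
  classical
  intro ω B hB hb
  have hfin : X ω B ≠ ∞ := by
    obtain ⟨n, hn⟩ := hX.counting ω B hB hb
    simp [hn]
  rw [hM.enumerates ω] at hfin ⊢
  obtain ⟨n₀, hn₀⟩ := exists_restrict_sum_dirac_eq
    (c := fun i : ℕ => (i : ℕ∞) < κ ω) (x := fun i => ξ i ω) hB hfin
  obtain ⟨l, hl⟩ := exists_diracSum_of_finset (Finset.range n₀)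
    (fun i : ℕ => (i : ℕ∞) < κ ω ∧ ξ i ω ∈ B) (fun i => ξ i ω)
  refine ⟨l, ?_⟩
  rw [← hl, ← hn₀ n₀ le_rfl]

/-- The configuration with the first `k` points of the sequence `x`. -/
noncomputable def config (k : ℕ∞) (x : ℕ → Space d) : Measure (Space d) :=
  Measure.sum (fun i : ℕ => if (i : ℕ∞) < k then Measure.dirac (x i) else 0)

/-- The ball moves with the configuration, so the count is written as a series of indicators of
measurable conditions on pairs of points. -/
lemma measurable_neighbourCount_config (i : ℕ) :
    Measurable fun q : ℕ∞ × (ℕ → Space d) => neighbourCount r (q.2 i) (config q.1 q.2) := by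
  classical
  refine Nat.measurable_floor.comp (Measurable.ennreal_toReal ?_)
  have h : ∀ q : ℕ∞ × (ℕ → Space d),
      config q.1 q.2 (Metric.closedBall (q.2 i) r \ {q.2 i}) =
        ∑' j : ℕ, if ((j : ℕ∞) < q.1 ∧ dist (q.2 j) (q.2 i) ≤ r) ∧ q.2 j ≠ q.2 i then
          (1 : ℝ≥0∞) else 0 := by
    intro q
    have hm : MeasurableSet (Metric.closedBall (q.2 i) r \ {q.2 i}) :=
      measurableSet_closedBall.diff (measurableSet_singleton _)
    rw [config, Measure.sum_apply _ hm]
    refine tsum_congr fun j => ?_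
    by_cases hj : (j : ℕ∞) < q.1
    · simp [hj, Measure.dirac_apply' _ hm, Set.indicator]
    · simp [hj]
  simp_rw [h]
  refine Measurable.tsum fun j => Measurable.ite ?_ measurable_const measurable_const
  have hx : ∀ k : ℕ, Measurable fun q : ℕ∞ × (ℕ → Space d) => q.2 k := fun k => by fun_prop
  refine MeasurableSet.inter (MeasurableSet.inter ?_ ?_) ?_
  · exact measurable_fst (MeasurableSet.of_discrete (s := Set.Ioi _))
  · exact measurableSet_le ((hx j).dist (hx i)) measurable_const
  · exact (measurableSet_eq_fun (hx j) (hx i)).compl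

lemma lintegral_mark {V : Ω → ℝ} (hV : HasLaw V (volume.restrict (Set.Ioo (0 : ℝ) 1)) P)
    {a q : ℝ} (hq : q ∈ Set.Icc (0 : ℝ) 1) :
    ∫⁻ ω, ENNReal.ofReal (Real.exp (-(if V ω ≤ q then a else 0))) ∂P =
      ENNReal.ofReal (1 - (1 - Real.exp (-a)) * q) := by
  have hm : Measurable fun u : ℝ => ENNReal.ofReal (Real.exp (-(if u ≤ q then a else 0))) := by
    have : Measurable fun u : ℝ => if u ≤ q then a else 0 :=
      Measurable.ite measurableSet_Iic measurable_const measurable_const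
    fun_prop
  rw [hV.lintegral_comp (f := fun u : ℝ => ENNReal.ofReal (Real.exp (-(if u ≤ q then a else 0))))
    hm.aemeasurable]
  rw [← lintegral_add_compl _ (measurableSet_Iic (a := q)),
    setLIntegral_congr_fun (g := fun _ => ENNReal.ofReal (Real.exp (-a))) measurableSet_Iic
      (fun u hu => by simp [Set.mem_Iic.1 hu]),
    setLIntegral_congr_fun (g := fun _ => 1) measurableSet_Iic.compl
      (fun u hu => by simp [show ¬ u ≤ q from hu])]
  have h1 : volume (Set.Iic q ∩ Set.Ioo 0 1) = ENNReal.ofReal q := by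
    refine le_antisymm ?_ ?_
    · calc volume (Set.Iic q ∩ Set.Ioo 0 1) ≤ volume (Set.Ioc 0 q) :=
          measure_mono fun u hu => ⟨hu.2.1, hu.1⟩
        _ = ENNReal.ofReal q := by simp
    · calc ENNReal.ofReal q = volume (Set.Ioo 0 q) := by simp
        _ ≤ volume (Set.Iic q ∩ Set.Ioo 0 1) :=
            measure_mono fun u hu => ⟨hu.2.le, hu.1, hu.2.trans_le hq.2⟩
  have h2 : volume ((Set.Iic q)ᶜ ∩ Set.Ioo 0 1) = ENNReal.ofReal (1 - q) := by
    have : (Set.Iic q)ᶜ ∩ Set.Ioo 0 1 = Set.Ioo q 1 := by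
      ext u
      simp only [Set.mem_inter_iff, Set.mem_compl_iff, Set.mem_Iic, not_le, Set.mem_Ioo]
      exact ⟨fun h => ⟨h.1, h.2.2⟩, fun h => ⟨h.1, hq.1.trans_lt h.1, h.2⟩⟩
    rw [this, Real.volume_Ioo]
  simp only [lintegral_const, Measure.restrict_apply_univ, Measure.restrict_restrict
    measurableSet_Iic, Measure.restrict_restrict measurableSet_Iic.compl, one_mul, h1, h2]
  rw [← ENNReal.ofReal_mul (Real.exp_pos _).le, ← ENNReal.ofReal_add
    (mul_nonneg (Real.exp_pos _).le hq.1) (by linarith [hq.2])]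
  congr 1
  ring

/-- The contribution of the `i`-th point to the sum of `g`, if it is retained. -/
noncomputable def pointValue (g : Space d → ℝ) (i : ℕ) (q : ℕ∞ × (ℕ → Space d)) : ℝ :=
  if (i : ℕ∞) < q.1 then g (q.2 i) else 0

/-- The retention probability of the `i`-th point. -/
noncomputable def pointRetention (r : ℝ) (p : ℕ → ℝ) (i : ℕ) (q : ℕ∞ × (ℕ → Space d)) : ℝ :=
  p (neighbourCount r (q.2 i) (config q.1 q.2))

lemma measurable_pointValue (hg : Measurable g) (i : ℕ) : Measurable (pointValue g i) :=
  Measurable.ite (measurable_fst (MeasurableSet.of_discrete (s := Set.Ioi _))) (by fun_prop) measurable_const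

lemma measurable_pointRetention (i : ℕ) : Measurable (pointRetention (d := d) r p i) :=
  (Measurable.of_discrete (f := p)).comp (measurable_neighbourCount_config i)

lemma pointValue_nonneg (hg : ∀ y, 0 ≤ g y) (i : ℕ) (q : ℕ∞ × (ℕ → Space d)) :
    0 ≤ pointValue g i q := by
  unfold pointValue
  split_ifs
  · exact hg _
  · exact le_rfl

/-- The factor `exp(-g)` of the `i`-th point if it is retained, and one otherwise. -/
noncomputable def markedFactor (r : ℝ) (p : ℕ → ℝ) (g : Space d → ℝ) (i : ℕ)
    (z : (ℕ∞ × (ℕ → Space d)) × (ℕ → ℝ)) : ℝ :=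
  Real.exp (-(if z.2 i ≤ pointRetention r p i z.1 then pointValue g i z.1 else 0))

/-- The mean of `markedFactor` over the mark. -/
noncomputable def meanFactor (r : ℝ) (p : ℕ → ℝ) (g : Space d → ℝ) (i : ℕ)
    (q : ℕ∞ × (ℕ → Space d)) : ℝ :=
  1 - (1 - Real.exp (-pointValue g i q)) * pointRetention r p i q

lemma measurable_markedFactor (hgm : Measurable g) (i : ℕ) :
    Measurable (markedFactor r p g i) := by
  refine Real.measurable_exp.comp (Measurable.neg (Measurable.ite ?_ ?_ measurable_const))
  · exact measurableSet_le (by fun_prop) ((measurable_pointRetention i).comp measurable_fst)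
  · exact (measurable_pointValue hgm i).comp measurable_fst

lemma measurable_meanFactor (hgm : Measurable g) (i : ℕ) : Measurable (meanFactor r p g i) := by
  have := measurable_pointValue hgm i
  have := measurable_pointRetention (d := d) (r := r) (p := p) i
  unfold meanFactor
  fun_prop

lemma markedFactor_mem_Icc (hg : ∀ y, 0 ≤ g y) (i : ℕ) (z : (ℕ∞ × (ℕ → Space d)) × (ℕ → ℝ)) :
    markedFactor r p g i z ∈ Set.Icc (0 : ℝ) 1 := by
  refine ⟨(Real.exp_pos _).le, Real.exp_le_one_iff.2 (neg_nonpos.2 ?_)⟩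
  split_ifs
  · exact pointValue_nonneg hg _ _
  · exact le_rfl

lemma meanFactor_mem_Icc (hp : ∀ n, p n ∈ Set.Icc (0 : ℝ) 1) (hg : ∀ y, 0 ≤ g y) (i : ℕ)
    (q : ℕ∞ × (ℕ → Space d)) : meanFactor r p g i q ∈ Set.Icc (0 : ℝ) 1 := by
  have h1 := Real.exp_pos (-pointValue g i q)
  have h2 := Real.exp_le_one_iff.2 (neg_nonpos.2 (pointValue_nonneg hg i q))
  have h3 : pointRetention r p i q ∈ Set.Icc (0 : ℝ) 1 := hp _
  unfold meanFactor
  constructor <;> nlinarith [h3.1, h3.2]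

/-- The marks of the first `n` points can be integrated out. -/
lemma integral_prod_marks [IsProbabilityMeasure P] (hM : IsUniformMarking P X κ ξ U)
    (hp : ∀ n, p n ∈ Set.Icc (0 : ℝ) 1) (hgm : Measurable g) (hg : ∀ y, 0 ≤ g y) (n : ℕ) :
    ∫ ω, ∏ i ∈ Finset.range n,
      markedFactor r p g i ((κ ω, fun j => ξ j ω), fun j => U j ω) ∂P =
    ∫ ω, ∏ i ∈ Finset.range n, meanFactor r p g i (κ ω, fun j => ξ j ω) ∂P := by
  have hκξ : Measurable fun ω => (κ ω, fun j => ξ j ω) :=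
    hM.measurable_card.prodMk (measurable_pi_lambda _ hM.measurable_point)
  have hUm : Measurable fun ω (j : ℕ) => U j ω := measurable_pi_lambda _ hM.measurable_mark
  have hφ := Finset.measurable_prod (Finset.range n)
    fun i _ => measurable_markedFactor (r := r) (p := p) hgm i
  have hψ := Finset.measurable_prod (Finset.range n)
    fun i _ => measurable_meanFactor (r := r) (p := p) hgm i
  rw [integral_eq_lintegral_of_nonneg_ae (ae_of_all _ fun ω => Finset.prod_nonneg fun i _ =>
      (markedFactor_mem_Icc hg i _).1) (hφ.comp (hκξ.prodMk hUm)).aestronglyMeasurable,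
    integral_eq_lintegral_of_nonneg_ae (ae_of_all _ fun ω => Finset.prod_nonneg fun i _ =>
      (meanFactor_mem_Icc hp hg i _).1) (hψ.comp hκξ).aestronglyMeasurable]
  congr 1
  -- The points are frozen: the retention thresholds become constants, while the marks remain
  -- independent and uniform.
  refine (lintegral_prod_of_indepFun hκξ hUm hM.indep_points.symm
    (ENNReal.measurable_ofReal.comp hφ)).trans (lintegral_congr fun ω => ?_)
  simp only [Function.comp_apply]
  rw [ENNReal.ofReal_prod_of_nonneg fun i _ => (meanFactor_mem_Icc hp hg i _).1]
  simp_rw [ENNReal.ofReal_prod_of_nonneg fun i (_ : i ∈ Finset.range n) =>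
    (markedFactor_mem_Icc (r := r) (p := p) hg i _).1]
  have hu : ∀ i, Measurable fun u : ℝ => ENNReal.ofReal (Real.exp
      (-(if u ≤ pointRetention r p i (κ ω, fun j => ξ j ω)
        then pointValue g i (κ ω, fun j => ξ j ω) else 0))) := fun i => by
    have : Measurable fun u : ℝ => if u ≤ pointRetention r p i (κ ω, fun j => ξ j ω)
        then pointValue g i (κ ω, fun j => ξ j ω) else 0 :=
      Measurable.ite measurableSet_Iic measurable_const measurable_const
    fun_prop
  have h2 := lintegral_prod_eq_prod_lintegral_of_indepFun (Finset.range n) _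
    (hM.mark_indep.comp _ hu) (fun i => (hu i).comp (hM.measurable_mark i))
  simp only [Function.comp_apply] at h2
  refine h2.trans (Finset.prod_congr rfl fun i _ => ?_)
  exact lintegral_mark (hM.mark_law i) (hp _)

lemma IsPointProcess.measure_ne_top (hX : IsPointProcess X) {W : Set (Space d)}
    (hW : MeasurableSet W) (hbW : Bornology.IsBounded W) (ω : Ω) : X ω W ≠ ∞ := by
  obtain ⟨n, hn⟩ := hX.counting ω W hW hbW
  simp [hn]

lemma exists_exp_neg_integral_thinning_eq (hX : IsPointProcess X)
    (hM : IsUniformMarking P X κ ξ U) {W : Set (Space d)}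
    (hW : MeasurableSet W) (hbW : Bornology.IsBounded W) (hgW : Function.support g ⊆ W) (ω : Ω) :
    ∃ n₀, ∀ n ≥ n₀, Real.exp (-∫ y, g y ∂(thinning r p X κ ξ U ω)) =
      ∏ i ∈ Finset.range n,
        markedFactor r p g i ((κ ω, fun j => ξ j ω), fun j => U j ω) := by
  have hXω : config (κ ω) (fun j => ξ j ω) = X ω := (hM.enumerates ω).symm
  have hfin : thinning r p X κ ξ U ω W ≠ ∞ := by
    refine ne_top_of_le_ne_top (hX.measure_ne_top hW hbW ω) ?_
    rw [hM.enumerates ω, thinning, Measure.sum_apply _ hW, Measure.sum_apply _ hW]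
    refine ENNReal.tsum_le_tsum fun i => ?_
    by_cases h1 : (i : ℕ∞) < κ ω
    · rw [if_pos h1]
      split_ifs
      · exact le_rfl
      · simp
    · simp [h1]
  obtain ⟨n₀, hn₀⟩ := @exists_integral_sum_dirac_eq _ _ _
    (fun i => (i : ℕ∞) < κ ω ∧ U i ω ≤ p (neighbourCount r (ξ i ω) (X ω))) _ _ _ hW hfin _ hgW
  refine ⟨n₀, fun n hn => ?_⟩
  rw [thinning, hn₀ n hn, ← Finset.sum_neg_distrib, Real.exp_sum]
  refine Finset.prod_congr rfl fun i _ => ?_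
  rw [markedFactor, pointRetention, pointValue, hXω]
  congr 2
  by_cases h1 : (i : ℕ∞) < κ ω <;> simp [h1]

/-- Restricting `X` to `C` changes nothing: points with nonzero rate lie in `W`, and `C` contains
their whole neighbourhoods. -/
lemma exists_exp_neg_energy_eq (hr : 0 ≤ r) (hX : IsPointProcess X)
    (hM : IsUniformMarking P X κ ξ U) (hp : ∀ n, p n ∈ Set.Icc (0 : ℝ) 1)
    (hg : ∀ y, 0 ≤ g y) {W C : Set (Space d)}
    (hW : MeasurableSet W) (hbW : Bornology.IsBounded W) (hgW : Function.support g ⊆ W)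
    (hWC : ∀ y ∈ W, Metric.closedBall y r ⊆ C) (ω : Ω) :
    ∃ n₀, ∀ n ≥ n₀, Real.exp (-energy r p g ((X ω).restrict C) 0) =
      ∏ i ∈ Finset.range n, meanFactor r p g i (κ ω, fun j => ξ j ω) := by
  have hXω : config (κ ω) (fun j => ξ j ω) = X ω := (hM.enumerates ω).symm
  have hg0 : ∀ y ∉ W, g y = 0 := fun y hy => Function.notMem_support.1 fun h => hy (hgW h)
  have henergy : energy r p g ((X ω).restrict C) 0 =
      ∫ y, rate p g y (neighbourCount r y (X ω)) ∂(X ω) := by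
    have h1 : ∀ y, rate p g y (neighbourCount r y ((X ω).restrict C + 0)) =
        rate p g y (neighbourCount r y (X ω)) := by
      intro y
      by_cases hy : y ∈ W
      · have hm : MeasurableSet (Metric.closedBall y r \ {y}) :=
          measurableSet_closedBall.diff (measurableSet_singleton y)
        rw [add_zero, neighbourCount, neighbourCount, Measure.restrict_apply hm,
          Set.inter_eq_left.2 (Set.sdiff_subset.trans (hWC y hy))]
      · rw [rate_eq_zero (hg0 y hy), rate_eq_zero (hg0 y hy)]
    unfold energy
    simp_rw [h1]
    refine setIntegral_eq_integral_of_forall_compl_eq_zero fun y hy => ?_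
    exact rate_eq_zero (hg0 y fun h => hy (hWC y h (Metric.mem_closedBall_self hr))) _
  have hfin : Measure.sum (fun i : ℕ => if (i : ℕ∞) < κ ω then Measure.dirac (ξ i ω) else 0) W
      ≠ ∞ := by
    have := hX.measure_ne_top hW hbW ω
    rwa [hM.enumerates ω] at this
  obtain ⟨n₀, hn₀⟩ := exists_integral_sum_dirac_eq hW hfin
    (f := fun y => rate p g y (neighbourCount r y (X ω)))
    (fun y hy => by
      by_contra h
      exact hy (rate_eq_zero (hg0 y h) _))
  refine ⟨n₀, fun n hn => ?_⟩
  have hsum : ∫ y, rate p g y (neighbourCount r y (X ω)) ∂(X ω) = ∑ i ∈ Finset.range n,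
      if (i : ℕ∞) < κ ω then rate p g (ξ i ω) (neighbourCount r (ξ i ω) (X ω)) else 0 := by
    rw [← hn₀ n hn]
    exact congrArg (fun ν => ∫ y, rate p g y (neighbourCount r y (X ω)) ∂ν) (hM.enumerates ω)
  rw [henergy, hsum, ← Finset.sum_neg_distrib, Real.exp_sum]
  refine Finset.prod_congr rfl fun i _ => ?_
  rw [meanFactor, pointRetention, pointValue, hXω]
  by_cases h1 : (i : ℕ∞) < κ ω
  · simp only [h1, if_true]
    exact exp_neg_rate hp hg _ _
  · simp [h1]

/-- The Laplace functional of the thinned process is a mean weight of the Poisson process. -/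
theorem laplaceFunctional_thinning [IsProbabilityMeasure P] (hr : 0 ≤ r) (hX : IsPointProcess X)
    (hM : IsUniformMarking P X κ ξ U) (hp : ∀ n, p n ∈ Set.Icc (0 : ℝ) 1) (hgm : Measurable g)
    (hg : ∀ y, 0 ≤ g y) {W C : Set (Space d)}
    (hW : MeasurableSet W) (hbW : Bornology.IsBounded W) (hgW : Function.support g ⊆ W)
    (hWC : ∀ y ∈ W, Metric.closedBall y r ⊆ C) :
    laplaceFunctional P (thinning r p X κ ξ U) g = (meanWeight P X r p g C 0).toReal := by
  have hκξ : Measurable fun ω => (κ ω, fun j => ξ j ω) :=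
    hM.measurable_card.prodMk (measurable_pi_lambda _ hM.measurable_point)
  have hUm : Measurable fun ω (j : ℕ) => U j ω := measurable_pi_lambda _ hM.measurable_mark
  have hφ := fun n => (Finset.measurable_prod (Finset.range n)
    fun i _ => measurable_markedFactor (r := r) (p := p) hgm i).comp (hκξ.prodMk hUm)
  have hψ := fun n => (Finset.measurable_prod (Finset.range n)
    fun i _ => measurable_meanFactor (r := r) (p := p) hgm i).comp hκξ
  have hlim : ∀ {a : ℕ → ℝ} {b : ℝ}, (∃ n₀, ∀ n ≥ n₀, b = a n) →
      Filter.Tendsto a Filter.atTop (nhds b) := by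
    rintro a b ⟨n₀, hn₀⟩
    exact tendsto_const_nhds.congr' (Filter.eventually_atTop.2 ⟨n₀, hn₀⟩)
  -- For each `ω` both products are eventually constant in `n`, and they are bounded by one, so the
  -- identity for finitely many points passes to the limit.
  have h1 := tendsto_integral_of_dominated_convergence (μ := P) (fun _ => (1 : ℝ))
    (fun n => (hφ n).aestronglyMeasurable) (integrable_const 1)
    (fun n => ae_of_all _ fun ω => by
      rw [Function.comp_apply, Real.norm_of_nonneg (Finset.prod_nonneg fun i _ => (markedFactor_mem_Icc hg i _).1)]
      exact Finset.prod_le_one (fun i _ => (markedFactor_mem_Icc hg i _).1)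
        fun i _ => (markedFactor_mem_Icc hg i _).2)
    (ae_of_all _ fun ω => hlim (exists_exp_neg_integral_thinning_eq hX hM hW hbW hgW ω))
  have hptw := fun ω => hlim
    (exists_exp_neg_energy_eq hr hX hM hp hg hW hbW hgW hWC ω)
  have h2 := tendsto_integral_of_dominated_convergence (μ := P) (fun _ => (1 : ℝ))
    (fun n => (hψ n).aestronglyMeasurable) (integrable_const 1)
    (fun n => ae_of_all _ fun ω => by
      rw [Function.comp_apply, Real.norm_of_nonneg (Finset.prod_nonneg fun i _ => (meanFactor_mem_Icc hp hg i _).1)]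
      exact Finset.prod_le_one (fun i _ => (meanFactor_mem_Icc hp hg i _).1)
        fun i _ => (meanFactor_mem_Icc hp hg i _).2)
    (ae_of_all _ hptw)
  have h3 : ∀ n, ∫ ω, ((fun z => ∏ i ∈ Finset.range n, markedFactor r p g i z) ∘
      fun ω => ((κ ω, fun j => ξ j ω), fun j => U j ω)) ω ∂P =
      ∫ ω, ((fun z => ∏ i ∈ Finset.range n, meanFactor r p g i z) ∘
        fun ω => (κ ω, fun j => ξ j ω)) ω ∂P :=
    fun n => integral_prod_marks hM hp hgm hg n
  simp_rw [h3] at h1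
  rw [laplaceFunctional, tendsto_nhds_unique h1 h2, integral_eq_lintegral_of_nonneg_ae
    (ae_of_all _ fun ω => (Real.exp_pos _).le)]
  · rfl
  · exact (measurable_of_tendsto_metrizable hψ
      (tendsto_pi_nhds.2 hptw)).aestronglyMeasurable

end Marks

/-! ### The Laplace functional of a Poisson process -/

section PoissonLaplace

variable {d : ℕ} {Ω : Type*} [MeasurableSpace Ω] {P : Measure Ω} {X : Ω → Measure (Space d)} {Λ : Measure (Space d)} {g : Space d → ℝ} {M : ℝ}

/-- The case of step functions: the counts are independent, and each factor is a Poisson generating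
function at `exp(-c j)`. -/
lemma lintegral_exp_neg_sum_count (hX : IsPoissonProcess P X Λ) {m : ℕ}
    {A : Fin m → Set (Space d)} (hA : ∀ j, MeasurableSet (A j))
    (hb : ∀ j, Bornology.IsBounded (A j)) (hdisj : ∀ i j, i ≠ j → Disjoint (A i) (A j))
    (c : Fin m → ℝ) :
    ∫⁻ ω, ENNReal.ofReal (Real.exp (-∑ j, c j * count (X ω) (A j))) ∂P =
      ENNReal.ofReal (Real.exp (-∑ j, (1 - Real.exp (-c j)) * (Λ (A j)).toReal)) := by
  let e : Fin m → ℝ≥0 := fun j => (Real.exp (-c j)).toNNReal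
  have he : ∀ j, (e j : ℝ) = Real.exp (-c j) := fun j => Real.coe_toNNReal _ (Real.exp_pos _).le
  let φ : Fin m → ℝ≥0∞ → ℝ≥0∞ := fun j t => (e j : ℝ≥0∞) ^ ⌊t.toReal⌋₊
  have hφ : ∀ j, Measurable (φ j) := fun j =>
    (Measurable.of_discrete (f := fun n : ℕ => (e j : ℝ≥0∞) ^ n)).comp
      (Nat.measurable_floor.comp ENNReal.measurable_toReal)
  have h1 : ∀ ω, ENNReal.ofReal (Real.exp (-∑ j, c j * count (X ω) (A j))) =
      ∏ j, φ j (X ω (A j)) := by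
    intro ω
    rw [← Finset.sum_neg_distrib, Real.exp_sum, ENNReal.ofReal_prod_of_nonneg
      fun j _ => (Real.exp_pos _).le]
    refine Finset.prod_congr rfl fun j _ => ?_
    rw [show -(c j * count (X ω) (A j)) = count (X ω) (A j) * -c j by ring, Real.exp_nat_mul,
      ENNReal.ofReal_pow (Real.exp_pos _).le]
    rfl
  simp_rw [h1]
  rw [lintegral_prod_eq_prod_lintegral_of_indepFun Finset.univ
    (fun j ω => φ j (X ω (A j))) ((hX.count_indep m A hA hb hdisj).comp φ hφ)
    (fun j => (hφ j).comp ((Measure.measurable_coe (hA j)).comp hX.isPointProcess.measurable)),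
    ← Finset.sum_neg_distrib, Real.exp_sum, ENNReal.ofReal_prod_of_nonneg
      fun j _ => (Real.exp_pos _).le]
  refine Finset.prod_congr rfl fun j _ => ?_
  have h2 := hX.lintegral_count (hA j) (hb j) (fun n => (e j : ℝ≥0∞) ^ n)
  rw [lintegral_pow_poissonMeasure, he, ENNReal.coe_toNNReal_eq_toReal] at h2
  refine h2.trans ?_
  congr 2
  ring

/-- The Laplace functional of a Poisson process. -/
theorem laplaceFunctional_poisson [IsProbabilityMeasure P] (hX : IsPoissonProcess P X Λ)
    [IsFiniteMeasureOnCompacts Λ] (hgm : Measurable g) (hg : ∀ y, 0 ≤ g y)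
    (hgM : ∀ y, g y ≤ M) {W : Set (Space d)}
    (hW : MeasurableSet W) (hbW : Bornology.IsBounded W) (hgW : Function.support g ⊆ W) :
    laplaceFunctional P X g = Real.exp (-(∫⁻ y, hit g y ∂Λ).toReal) := by
  have hg0 : ∀ y ∉ W, g y = 0 := fun y hy => Function.notMem_support.1 fun h => hy (hgW h)
  -- `g` is rounded down to multiples of `1 / k`, with level sets `A k j`; `m k` levels suffice
  -- since `g ≤ M`. At `k = 0`, division by zero makes `s 0` vanish, which is harmless.
  let m : ℕ → ℕ := fun k => ⌊M * k⌋₊ + 1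
  let A : (k : ℕ) → Fin (m k) → Set (Space d) := fun k j => W ∩ {y | ⌊g y * k⌋₊ = j}
  let s : ℕ → Space d → ℝ := fun k y => (⌊g y * k⌋₊ : ℝ) / k
  have hfl : ∀ k : ℕ, Measurable fun y => ⌊g y * k⌋₊ := fun k =>
    Nat.measurable_floor.comp (hgm.mul_const _)
  have hAm : ∀ k j, MeasurableSet (A k j) := fun k j =>
    hW.inter (hfl k (measurableSet_singleton _))
  have hAb : ∀ k j, Bornology.IsBounded (A k j) := fun k j => hbW.subset Set.inter_subset_left
  have hAd : ∀ k i j, i ≠ j → Disjoint (A k i) (A k j) := fun k i j hij => by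
    rw [Set.disjoint_left]
    rintro y ⟨_, h1⟩ ⟨_, h2⟩
    exact hij (Fin.ext (h1.symm.trans h2))
  have hsm : ∀ k, Measurable (s k) := fun k =>
    ((Measurable.of_discrete (f := fun n : ℕ => (n : ℝ))).comp (hfl k)).div_const _
  have hs0 : ∀ k y, 0 ≤ s k y := fun k y => by positivity
  have hsg : ∀ k y, s k y ≤ g y := fun k y => by
    rcases Nat.eq_zero_or_pos k with rfl | hk
    · simpa [s] using hg y
    · have hk' : (0 : ℝ) < k := by exact_mod_cast hk
      exact (div_le_iff₀ hk').2 (Nat.floor_le (mul_nonneg (hg y) hk'.le))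
  have hslim : ∀ y, Filter.Tendsto (fun k => s k y) Filter.atTop (nhds (g y)) := fun y =>
    (tendsto_nat_floor_mul_div_atTop (hg y)).comp tendsto_natCast_atTop_atTop
  have hsA : ∀ (k : ℕ) (F : ℝ → ℝ≥0∞) (ν : Measure (Space d)), F 0 = 0 →
      ∫⁻ y, F (s k y) ∂ν = ∑ j : Fin (m k), F ((j : ℕ) / (k : ℝ)) * ν (A k j) := by
    intro k F ν hF
    have h1 : ∀ y, F (s k y) = ∑ j : Fin (m k), (A k j).indicator (fun _ => F ((j : ℕ) / (k : ℝ))) y := by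
      intro y
      by_cases hy : y ∈ W
      · have hlt : ⌊g y * k⌋₊ < m k :=
          Nat.lt_succ_of_le (Nat.floor_le_floor (by gcongr; exact hgM y))
        rw [Finset.sum_eq_single ⟨_, hlt⟩]
        · rw [Set.indicator_of_mem]
          exact ⟨hy, rfl⟩
        · intro j _ hj
          refine Set.indicator_of_notMem (fun h => hj (Fin.ext h.2.symm)) _
        · simp
      · have : s k y = 0 := by simp [s, hg0 y hy]
        rw [this, hF, Finset.sum_eq_zero]
        intro j _
        exact Set.indicator_of_notMem (fun h => hy h.1) _
    simp_rw [h1]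
    rw [lintegral_finsetSum _ fun j _ => measurable_const.indicator (hAm k j)]
    refine Finset.sum_congr rfl fun j _ => ?_
    rw [lintegral_indicator_const (hAm k j)]
  have hfW : ∀ ω, IsFiniteMeasure ((X ω).restrict W) := fun ω =>
    ⟨by simpa using (hX.isPointProcess.measure_ne_top hW hbW ω).lt_top⟩
  have hint : ∀ (f : Space d → ℝ) (ω : Ω), (∀ y ∉ W, f y = 0) →
      ∫ y, f y ∂(X ω) = ∫ y in W, f y ∂(X ω) := fun f ω hf =>
    (setIntegral_eq_integral_of_forall_compl_eq_zero hf).symm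
  have hsW : ∀ k, ∀ y ∉ W, s k y = 0 := fun k y hy => by simp [s, hg0 y hy]
  have hcount : ∀ k ω, ∫ y, s k y ∂(X ω) =
      ∑ j : Fin (m k), ((j : ℕ) / (k : ℝ)) * count (X ω) (A k j) := by
    intro k ω
    rw [integral_eq_lintegral_of_nonneg_ae (ae_of_all _ (hs0 k)) (hsm k).aestronglyMeasurable,
      hsA k ENNReal.ofReal (X ω) (by simp), ENNReal.toReal_sum]
    · refine Finset.sum_congr rfl fun j _ => ?_
      rw [ENNReal.toReal_mul, ENNReal.toReal_ofReal (by positivity),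
        ← hX.isPointProcess.coe_count (hAm k j) (hAb k j), ENNReal.toReal_natCast]
    · intro j _
      exact ENNReal.mul_ne_top ENNReal.ofReal_ne_top
        (hX.isPointProcess.measure_ne_top (hAm k j) (hAb k j) ω)
  have hcm : ∀ k, Measurable fun ω => ∫ y, s k y ∂(X ω) := fun k => by
    simp_rw [hcount]
    refine Finset.measurable_sum _ fun j _ => Measurable.const_mul ?_ _
    exact (Measurable.of_discrete (f := fun n : ℕ => (n : ℝ))).comp
      (measurable_count hX.isPointProcess.measurable (hAm k j))
  have hem : ∀ k, Measurable fun ω => Real.exp (-∫ y, s k y ∂(X ω)) := fun k =>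
    Real.measurable_exp.comp (hcm k).neg
  have hsimple : ∀ k, ∫ ω, Real.exp (-∫ y, s k y ∂(X ω)) ∂P =
      Real.exp (-(∫⁻ y, hit (s k) y ∂Λ).toReal) := by
    intro k
    rw [integral_eq_lintegral_of_nonneg_ae (ae_of_all _ fun ω => (Real.exp_pos _).le)
      (hem k).aestronglyMeasurable]
    simp_rw [hcount]
    rw [lintegral_exp_neg_sum_count hX (hAm k) (hAb k) (hAd k)
      (fun j : Fin (m k) => ((j : ℕ) / (k : ℝ))), ENNReal.toReal_ofReal (Real.exp_pos _).le]
    have h := hsA k (fun t => ENNReal.ofReal (1 - Real.exp (-t))) Λ (by simp)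
    unfold hit
    rw [h, ENNReal.toReal_sum]
    · congr 2
      refine Finset.sum_congr rfl fun j _ => ?_
      rw [ENNReal.toReal_mul, ENNReal.toReal_ofReal]
      have : Real.exp (-((j : ℕ) / (k : ℝ))) ≤ 1 :=
        Real.exp_le_one_iff.2 (neg_nonpos.2 (by positivity))
      linarith
    · intro j _
      exact ENNReal.mul_ne_top ENNReal.ofReal_ne_top ((hAb k j).measure_lt_top).ne
  have hlim1 : Filter.Tendsto (fun k => ∫ ω, Real.exp (-∫ y, s k y ∂(X ω)) ∂P) Filter.atTop
      (nhds (laplaceFunctional P X g)) := by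
    refine tendsto_integral_of_dominated_convergence (fun _ => (1 : ℝ))
      (fun k => (hem k).aestronglyMeasurable) (integrable_const 1)
      (fun k => ae_of_all _ fun ω => ?_) (ae_of_all _ fun ω => ?_)
    · rw [Real.norm_of_nonneg (Real.exp_pos _).le, Real.exp_le_one_iff, neg_nonpos]
      exact integral_nonneg (hs0 k)
    · refine (Real.continuous_exp.tendsto _).comp (Filter.Tendsto.neg ?_)
      simp_rw [hint g ω hg0, fun k => hint (s k) ω (hsW k)]
      have := hfW ω
      refine tendsto_integral_of_dominated_convergence (fun _ => M)
        (fun k => (hsm k).aestronglyMeasurable) (integrable_const M)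
        (fun k => ae_of_all _ fun y => ?_) (ae_of_all _ hslim)
      rw [Real.norm_of_nonneg (hs0 k y)]
      exact (hsg k y).trans (hgM y)
  have hfin : ∫⁻ y, hit g y ∂Λ ≠ ∞ := by
    have h := lintegral_hit_indicator_le hgM hW Λ
    rw [Set.indicator_eq_self.2 hgW] at h
    exact ne_top_of_le_ne_top (ENNReal.mul_ne_top ENNReal.ofReal_ne_top hbW.measure_lt_top.ne) h
  have hlim2 : Filter.Tendsto (fun k => Real.exp (-(∫⁻ y, hit (s k) y ∂Λ).toReal)) Filter.atTop
      (nhds (Real.exp (-(∫⁻ y, hit g y ∂Λ).toReal))) := by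
    refine (Real.continuous_exp.tendsto _).comp (Filter.Tendsto.neg ?_)
    refine (ENNReal.tendsto_toReal hfin).comp ?_
    refine tendsto_lintegral_of_dominated_convergence (hit g) (fun k => measurable_hit (hsm k))
      (fun k => ae_of_all _ fun y => ?_) hfin (ae_of_all _ fun y => ?_)
    · refine ENNReal.ofReal_le_ofReal (sub_le_sub_left (Real.exp_le_exp.2 ?_) _)
      exact neg_le_neg (hsg k y)
    · refine (ENNReal.continuous_ofReal.tendsto _).comp ?_
      exact tendsto_const_nhds.sub ((Real.continuous_exp.tendsto _).comp (hslim y).neg)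
  simp_rw [hsimple] at hlim1
  exact tendsto_nhds_unique hlim1 hlim2

end PoissonLaplace

/-! ### The mean retention probability and the constants -/

/-- `p n` and `p 0` differ by at most one, and not at all for `n = 0`, hence by at most `n`; the
Poisson mean is `a`. -/
lemma abs_integral_poissonMeasure_sub_le {p : ℕ → ℝ} (hp : ∀ n, p n ∈ Set.Icc (0 : ℝ) 1)
    (a : ℝ≥0) : |∫ n, p n ∂(poissonMeasure a) - p 0| ≤ a := by
  have hpi : Integrable p (poissonMeasure a) := by
    refine Integrable.of_bound (C := 1) Measurable.of_discrete.aestronglyMeasurable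
      (ae_of_all _ fun n => ?_)
    rw [Real.norm_of_nonneg (hp n).1]
    exact (hp n).2
  have h1 : ∫ n, p n ∂(poissonMeasure a) - p 0 = ∫ n, (p n - p 0) ∂(poissonMeasure a) := by
    rw [integral_sub hpi (integrable_const _)]
    simp
  have h2 : ∫⁻ n : ℕ, (n : ℝ≥0∞) ∂(poissonMeasure a) = a := by
    have := lintegral_mul_poissonMeasure a (fun _ => 1)
    simpa using this
  rw [h1, ← Real.norm_eq_abs]
  refine (norm_integral_le_lintegral_norm _).trans ?_
  refine ENNReal.toReal_le_of_le_ofReal a.2 ?_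
  rw [show ENNReal.ofReal (a : ℝ) = a from ENNReal.ofReal_coe_nnreal, ← h2]
  refine lintegral_mono fun n => ?_
  rw [← ENNReal.ofReal_natCast]
  refine ENNReal.ofReal_le_ofReal ?_
  rcases Nat.eq_zero_or_pos n with rfl | hn
  · simp
  · have : (1 : ℝ) ≤ n := by exact_mod_cast hn
    rw [Real.norm_eq_abs, abs_le]
    constructor <;> linarith [(hp n).1, (hp n).2, (hp 0).1, (hp 0).2]

lemma toReal_smul_volume_closedBall {d : ℕ} {lam : ℝ} (hlam : 0 ≤ lam) (x : Space d) {s : ℝ}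
    (hs : 0 ≤ s) :
    ((ENNReal.ofReal lam • (volume : Measure (Space d))) (Metric.closedBall x s)).toReal =
      lam * unitBallVolume d * s ^ d := by
  rw [Measure.smul_apply, Measure.addHaar_closedBall' _ _ hs, smul_eq_mul, ENNReal.toReal_mul,
    ENNReal.toReal_mul, ENNReal.toReal_ofReal hlam, ENNReal.toReal_ofReal (by positivity),
    finrank_euclideanSpace, Fintype.card_fin, unitBallVolume]
  ring

end LocalThinning

/-! ### The theorem -/

theorem mainTheorem4 (d : ℕ) (hd : 1 ≤ d) :
    ∃ c C : ℝ, 0 < c ∧ 0 < C ∧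
      ∀ (lam r : ℝ) (p : ℕ → ℝ) (W : Set (LocalThinning.Space d)) (g : LocalThinning.Space d → ℝ),
        0 < lam → 0 < r → (∀ n, p n ∈ Set.Icc (0 : ℝ) 1) →
        MeasurableSet W → Bornology.IsBounded W →
        Measurable g → (∀ x, 0 ≤ g x) → BddAbove (Set.range g) → Function.support g ⊆ W →
        lam * r ^ d ≤ c →
      ∀ (Ω : Type*) [MeasurableSpace Ω] (P : Measure Ω) [IsProbabilityMeasure P]
        (X : Ω → Measure (LocalThinning.Space d)) (κ : Ω → ℕ∞)
        (ξ : ℕ → Ω → LocalThinning.Space d) (U : ℕ → Ω → ℝ),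
        LocalThinning.IsPoissonProcess P X (ENNReal.ofReal lam • volume) →
        LocalThinning.IsUniformMarking P X κ ξ U →
      ∀ (Ω' : Type*) [MeasurableSpace Ω'] (P' : Measure Ω') [IsProbabilityMeasure P']
        (Pi : Ω' → Measure (LocalThinning.Space d)),
        LocalThinning.IsPoissonProcess P' Pi
          (ENNReal.ofReal (lam * LocalThinning.meanRetention d lam r p) • volume.restrict W) →
        0 < LocalThinning.laplaceFunctional P' Pi g ∧
        0 < LocalThinning.laplaceFunctional P (LocalThinning.thinning r p X κ ξ U) g ∧
        |Real.log (LocalThinning.laplaceFunctional P' Pi g) -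
            Real.log (LocalThinning.laplaceFunctional P (LocalThinning.thinning r p X κ ξ U) g)|
          ≤ C * lam ^ 2 * (⨆ x, g x) * (volume W).toReal * (2 * r) ^ d := by
  have hv : 0 ≤ LocalThinning.unitBallVolume d := ENNReal.toReal_nonneg
  -- The first constant makes `β`, the mean number of points in a ball of radius `2r`, at most
  -- `1/100`. Adding one to the unit ball volume gives positivity of the constants from its
  -- nonnegativity alone.
  refine ⟨1 / (100 * 2 ^ d * (LocalThinning.unitBallVolume d + 1)),
    16 * (LocalThinning.unitBallVolume d + 1), by positivity, by positivity, ?_⟩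
  intro lam r p W g hlam hr hp hW hbW hgm hg hgb hgW hc Ω _ P _ X κ ξ U hX hM Ω' _ P' _ Pi hPi
  set v := LocalThinning.unitBallVolume d with hvdef
  set M := ⨆ x, g x with hMdef
  have hgM : ∀ y, g y ≤ M := fun y => le_ciSup hgb y
  have hM0 : 0 ≤ M := (hg 0).trans (hgM 0)
  set Λ : Measure (LocalThinning.Space d) := ENNReal.ofReal lam • volume with hΛ
  have hΛc : IsFiniteMeasureOnCompacts Λ :=
    IsFiniteMeasureOnCompacts.smul volume ENNReal.ofReal_ne_top
  set m := LocalThinning.meanRetention d lam r p with hmdef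
  have hm0 : 0 ≤ m := integral_nonneg fun n => (hp n).1
  obtain ⟨ρ, hρ⟩ := hbW.subset_closedBall 0
  set β := lam * v * (2 * r) ^ d with hβdef
  have hβ : ∀ x, (Λ (Metric.closedBall x (2 * r))).toReal = β := fun x =>
    LocalThinning.toReal_smul_volume_closedBall hlam.le x (by positivity)
  have hβ0 : 0 ≤ β := by positivity
  have hβ' : β ≤ 1 / 100 := by
    have h1 : lam * r ^ d * (100 * 2 ^ d * (v + 1)) ≤ 1 :=
      (le_div_iff₀ (by positivity)).1 hc
    have h2 : 0 ≤ lam * r ^ d * 2 ^ d := by positivity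
    rw [hβdef, mul_pow]
    linarith
  have hμβ : lam * v * r ^ d ≤ β := by
    rw [hβdef]
    gcongr
    linarith
  have hμ : ∀ x, (Λ (Metric.closedBall x r)).toReal ≤ 1 / 4 := fun x => by
    rw [LocalThinning.toReal_smul_volume_closedBall hlam.le x hr.le]
    linarith
  have hmβ : |m - p 0| ≤ β := by
    refine (LocalThinning.abs_integral_poissonMeasure_sub_le hp _).trans ?_
    rw [Real.coe_toNNReal _ (by positivity)]
    exact hμβ
  have hY := LocalThinning.laplaceFunctional_thinning (C := Metric.closedBall 0 (ρ + 2 * r)) hr.le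
    hX.isPointProcess hM hp hgm hg hW hbW hgW fun y hy =>
      Metric.closedBall_subset_closedBall' (by linarith [Metric.mem_closedBall.1 (hρ hy)])
  obtain ⟨hpos, hlog⟩ := LocalThinning.abs_log_meanWeight_add_le hr hX
    (hM.isLocallyDiracSum hX.isPointProcess) hp hgm hg hgM hW hρ hgW hμ hβ hβ' hmβ
  have hPifin : IsFiniteMeasureOnCompacts
      (ENNReal.ofReal (lam * m) • (volume.restrict W : Measure (LocalThinning.Space d))) :=
    IsFiniteMeasureOnCompacts.smul _ ENNReal.ofReal_ne_top
  have hPiL := LocalThinning.laplaceFunctional_poisson hPi hgm hg hgM hW hbW hgW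
  have hsupp : ∫⁻ y in W, LocalThinning.hit g y = ∫⁻ y, LocalThinning.hit g y := by
    refine setLIntegral_eq_of_support_subset fun y hy => ?_
    by_contra hyW
    exact hy (by simp [LocalThinning.hit, Function.notMem_support.1 fun h => hyW (hgW h)])
  have hint : (∫⁻ y, LocalThinning.hit g y
      ∂(ENNReal.ofReal (lam * m) • (volume.restrict W : Measure (LocalThinning.Space d)))).toReal =
      m * (∫⁻ y, LocalThinning.hit g y ∂Λ).toReal := by
    rw [lintegral_smul_measure, hsupp, hΛ, lintegral_smul_measure, smul_eq_mul, smul_eq_mul,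
      ENNReal.toReal_mul, ENNReal.toReal_mul, ENNReal.toReal_ofReal hlam.le,
      ENNReal.toReal_ofReal (by positivity)]
    ring
  rw [hint] at hPiL
  rw [hY, hPiL]
  refine ⟨Real.exp_pos _, hpos, ?_⟩
  rw [Real.log_exp, ← abs_neg, neg_sub, sub_neg_eq_add]
  refine hlog.trans ?_
  -- Only here is the saturating factor traded for the supremum of `g`.
  have hG : 1 - Real.exp (-M) ≤ M := by linarith [Real.add_one_le_exp (-M)]
  have hΛW : (Λ W).toReal = lam * (volume W).toReal := by
    rw [hΛ, Measure.smul_apply, smul_eq_mul, ENNReal.toReal_mul, ENNReal.toReal_ofReal hlam.le]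
  have hW0 : 0 ≤ (volume W).toReal := ENNReal.toReal_nonneg
  rw [hΛW]
  calc 16 * ((1 - Real.exp (-M)) * (lam * (volume W).toReal) * β)
      ≤ 16 * (M * (lam * (volume W).toReal) * (lam * (v + 1) * (2 * r) ^ d)) := by
        rw [hβdef]
        gcongr
        linarith
    _ = _ := by ring
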